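/- All manifolds below are topological manifolds without boundary (Hausdorff, second countable, locally homeomorphic to $\mathbb{R}^n$); they are not assumed to be compact, orientable or smooth. A connected sum $M_1\# M_2$ of two $n$-manifolds is obtained from open embeddings $e_i:\mathbb{R}^n\to M_i$ ($i=1,2$) by removing from each $M_i$ the image $e_i(B)$ of the open unit ball $B\subset\mathbb{R}^n$ and gluing $M_1\setminus e_1(B)$ to $M_2\setminus e_2(B)$ by identifying $e_1(x)$ with $e_2(x)$ for all $x$ in the unit sphere $S^{n-1}$. An $n$-manifold is a homotopy sphere if it is compact and homotopy equivalent to $S^n$. An $n$-manifold $M$ is irreducible if, whenever $M$ is homeomorphic to a connected sum $M_1\# M_2$ of two $n$-manifolds, at least one of $M_1$, $M_2$ is a homotopy sphere. **Lemma.** Let $M$ be a $4$-manifold whose universal covering is homeomorphic to $\mathbb{R}^4$. Then $M$ is irreducible. -/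

import Mathlib

open Metric Topology

/-- A surjective covering map with simply connected (so path connected) total space: a universal
covering of its base. -/
structure IsUniversalCovering {E M : Type*} [TopologicalSpace E] [TopologicalSpace M]
    (p : E → M) : Prop where
  simplyConnected : SimplyConnectedSpace E
  isCoveringMap : IsCoveringMap p
  surjective : Function.Surjective p

/-- The complement in `X` of the image of the open unit ball of `ℝⁿ` under `e : ℝⁿ → X`. -/
def ballComplement {n : ℕ} {X : Type*} (e : EuclideanSpace ℝ (Fin n) → X) : Set X :=
  (e '' ball 0 1)ᶜ

/-- The gluing relation of a connected sum: for `x` in the unit sphere of `ℝⁿ`, the point `e₁ x` of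
the first punctured summand is related to the point `e₂ x` of the second one. -/
def ConnectedSumRel {n : ℕ} {X₁ X₂ : Type*}
    (e₁ : EuclideanSpace ℝ (Fin n) → X₁) (e₂ : EuclideanSpace ℝ (Fin n) → X₂)
    (s t : ballComplement e₁ ⊕ ballComplement e₂) : Prop :=
  ∃ x ∈ sphere (0 : EuclideanSpace ℝ (Fin n)) 1,
    ∃ (a : ballComplement e₁) (b : ballComplement e₂),
      s = Sum.inl a ∧ t = Sum.inr b ∧ (a : X₁) = e₁ x ∧ (b : X₂) = e₂ x

/-- The connected sum `X₁ # X₂` formed along `e₁ : ℝⁿ → X₁` and `e₂ : ℝⁿ → X₂` (to be used for open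
embeddings into `n`-manifolds): remove from each summand the image of the open unit ball and glue
the resulting boundary spheres by `e₁ x ∼ e₂ x`. Precomposing `e₂` with a reflection gives the
connected sum with the other identification of the boundary spheres. -/
def ConnectedSum {n : ℕ} {X₁ X₂ : Type*}
    (e₁ : EuclideanSpace ℝ (Fin n) → X₁) (e₂ : EuclideanSpace ℝ (Fin n) → X₂) : Type _ :=
  Quot (ConnectedSumRel e₁ e₂)

/-- The quotient topology of the disjoint union of the two punctured summands. -/
instance ConnectedSum.instTopologicalSpace {n : ℕ} {X₁ X₂ : Type*} [TopologicalSpace X₁] [TopologicalSpace X₂]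
    (e₁ : EuclideanSpace ℝ (Fin n) → X₁) (e₂ : EuclideanSpace ℝ (Fin n) → X₂) :
    TopologicalSpace (ConnectedSum e₁ e₂) :=
  inferInstanceAs (TopologicalSpace (Quot (ConnectedSumRel e₁ e₂)))

/-- `M` is homeomorphic to a connected sum of `X₁` and `X₂`, formed along some embedded balls. -/
def IsConnectedSum (n : ℕ) (M X₁ X₂ : Type*) [TopologicalSpace M]
    [TopologicalSpace X₁] [TopologicalSpace X₂] : Prop :=
  ∃ (e₁ : EuclideanSpace ℝ (Fin n) → X₁) (e₂ : EuclideanSpace ℝ (Fin n) → X₂),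
    IsOpenEmbedding e₁ ∧ IsOpenEmbedding e₂ ∧ Nonempty (M ≃ₜ ConnectedSum e₁ e₂)

/-- An `n`-manifold `X` (without boundary) is a homotopy sphere if it is closed and homotopy
equivalent to the unit sphere of `ℝⁿ⁺¹`. -/
def IsHomotopySphere (n : ℕ) (X : Type*) [TopologicalSpace X] : Prop :=
  CompactSpace X ∧
    Nonempty (ContinuousMap.HomotopyEquiv X (sphere (0 : EuclideanSpace ℝ (Fin (n + 1))) 1))

universe u v w

/-- An `n`-manifold `M` is irreducible (under connected sum) if, whenever it is a connected sum of
two `n`-manifolds, one of the summands is a homotopy sphere. The manifolds are topological manifolds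
without boundary, Hausdorff and second countable, not necessarily compact. -/
def IsIrreducibleManifold (n : ℕ) (M : Type u) [TopologicalSpace M] : Prop :=
  ∀ (M₁ : Type v) (M₂ : Type w)
    [TopologicalSpace M₁] [T2Space M₁] [SecondCountableTopology M₁]
    [ChartedSpace (EuclideanSpace ℝ (Fin n)) M₁]
    [TopologicalSpace M₂] [T2Space M₂] [SecondCountableTopology M₂]
    [ChartedSpace (EuclideanSpace ℝ (Fin n)) M₂],
    IsConnectedSum n M M₁ M₂ → IsHomotopySphere n M₁ ∨ IsHomotopySphere n M₂

/-!
Let `c` be the bicollared sphere in `M` along which the summands are glued, and `p : ℝⁿ → M` the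
covering. For `n ≥ 3` the collar lifts to `ℝⁿ` through any point over it
(`IsCoveringMap.exists_continuousOn_lift_compl_singleton`), and by simple connectedness of `ℝⁿ` a
lifted sphere separates `ℝⁿ` into a bounded and an unbounded side
(`IsCollar.exists_separating_function`). A compact set contains only finitely many points of a fibre
of `p`, hence only finitely many lifted spheres, so that there is one whose bounded side `U` meets no
other (`exists_innermost_lift`). The collar runs from the sphere into one of the two summands on the side
of `U`, say into `M₁`. Then `p` restricts to a homeomorphism of the compact closure of `U` onto `M₁`
without the open ball: it is surjective as `M` is connected, and injective as the set of points that
share their image with another point is open and closed in `ℝⁿ` and bounded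
(`IsInnermost.surjOn_union`, `IsInnermost.injOn_union`).

Filling the rest by the removed ball along the collar gives a map from `Sⁿ = ℝⁿ ∪ {∞}` onto `M₁` whose
only nondegenerate fibre is the outside `Z` of `U` and its collar
(`IsInnermost.exists_map_onePoint`), so that `M₁` is `Sⁿ / Z`. Collapsing moreover the complement of
the cell in `M₁` gives a map of `Sⁿ` onto itself with just two nondegenerate fibres. By M. Brown's
argument for the generalized Schoenflies theorem these fibres are cellular
(`isCellular_fiber_of_two`), and collapsing a cellular set does not change the sphere
(`IsCellular.exists_collapse`, `exists_collapse_of_two_fibers`). Hence `M₁` is homeomorphic to `Sⁿ`.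
-/

section

open Set Filter

/-! ### Radial maps of a normed space -/

section Radial

variable {V : Type*} [NormedAddCommGroup V] [NormedSpace ℝ V]

/-- The map of a normed space that keeps directions and changes the norm from `t` to `ρ t`. -/
noncomputable def radialMap (ρ : ℝ → ℝ) (x : V) : V := (ρ ‖x‖ / ‖x‖) • x

theorem norm_radialMap {ρ : ℝ → ℝ} (h0 : ρ 0 = 0) (hρ : ∀ t, 0 < t → 0 < ρ t) (x : V) :
    ‖radialMap ρ x‖ = ρ ‖x‖ := by
  rcases eq_or_ne x 0 with rfl | hx
  · simp [radialMap, h0]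
  · have := norm_pos_iff.2 hx
    rw [radialMap, norm_smul, Real.norm_of_nonneg (div_nonneg (hρ _ this).le this.le)]
    field_simp

theorem radialMap_eq_self {ρ : ℝ → ℝ} {x : V} (h : ρ ‖x‖ = ‖x‖) : radialMap ρ x = x := by
  rcases eq_or_ne x 0 with rfl | hx
  · simp [radialMap]
  · have := norm_pos_iff.2 hx
    rw [radialMap, h, div_self this.ne', one_smul]

theorem radialMap_radialMap {ρ σ : ℝ → ℝ} (h0 : ρ 0 = 0) (hρ : ∀ t, 0 < t → 0 < ρ t) {x : V}
    (h : σ (ρ ‖x‖) = ‖x‖) : radialMap σ (radialMap ρ x) = x := by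
  rcases eq_or_ne x 0 with rfl | hx
  · simp [radialMap]
  · have hx' := norm_pos_iff.2 hx
    have := hρ _ hx'
    rw [radialMap, norm_radialMap h0 hρ, h, radialMap, smul_smul]
    rw [div_mul_div_comm, mul_comm, div_self (by positivity), one_smul]

theorem continuousAt_radialMap {ρ : ℝ → ℝ} (h0 : ρ 0 = 0) (hρ : ∀ t, 0 < t → 0 < ρ t) {x : V}
    (h : ContinuousAt ρ ‖x‖) : ContinuousAt (radialMap ρ : V → V) x := by
  rcases eq_or_ne x 0 with rfl | hx
  · have h1 : radialMap ρ (0 : V) = 0 := by simp [radialMap]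
    rw [ContinuousAt, h1, tendsto_zero_iff_norm_tendsto_zero]
    simp only [norm_radialMap h0 hρ]
    have h2 : Tendsto (fun y : V => ρ ‖y‖) (𝓝 0) (𝓝 (ρ ‖(0 : V)‖)) :=
      Tendsto.comp h continuous_norm.continuousAt
    simpa [h0] using h2
  · have h2 : ContinuousAt (fun y : V => ρ ‖y‖) x :=
      ContinuousAt.comp (g := ρ) h continuous_norm.continuousAt
    exact (h2.div continuous_norm.continuousAt (norm_ne_zero_iff.2 hx)).smul continuousAt_id

/-- A normed space is squeezed into any of its balls by an open embedding that fixes the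
concentric ball of half the radius pointwise. -/
theorem exists_isOpenEmbedding_range_eq_ball (a : V) {ε : ℝ} (hε : 0 < ε) :
    ∃ g : V → V, IsOpenEmbedding g ∧ range g = ball a ε ∧ ∀ x ∈ closedBall a (ε / 2), g x = x := by
  -- `ρ` is the identity up to `ε / 2` and `t ↦ ε - ε² / (4 t)` after that; `σ` is its inverse.
  let ρ : ℝ → ℝ := fun t => min t (ε / 2) + (ε / 2 - ε ^ 2 / (4 * max t (ε / 2)))
  let σ : ℝ → ℝ := fun r => min r (ε / 2) + (ε ^ 2 / (4 * (ε - max r (ε / 2))) - ε / 2)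
  have ρ_le : ∀ t, t ≤ ε / 2 → ρ t = t := fun t ht => by
    simp only [ρ, min_eq_left ht, max_eq_right ht]; field_simp; ring
  have ρ_ge : ∀ t, ε / 2 ≤ t → ρ t = ε - ε ^ 2 / (4 * t) := fun t ht => by
    simp only [ρ, min_eq_right ht, max_eq_left ht]; ring
  have σ_le : ∀ t, t ≤ ε / 2 → σ t = t := fun t ht => by
    simp only [σ, min_eq_left ht, max_eq_right ht]; field_simp; ring
  have σ_ge : ∀ t, ε / 2 ≤ t → σ t = ε ^ 2 / (4 * (ε - t)) := fun t ht => by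
    simp only [σ, min_eq_right ht, max_eq_left ht]; ring
  have ρ0 : ρ 0 = 0 := ρ_le 0 (by positivity)
  have σ0 : σ 0 = 0 := σ_le 0 (by positivity)
  have ρ_ge' : ∀ t, ε / 2 ≤ t → ε / 2 ≤ ρ t ∧ ρ t < ε := fun t ht => by
    have h0 : 0 < t := by linarith
    rw [ρ_ge t ht]
    have h1 : ε ^ 2 / (4 * t) ≤ ε / 2 := by
      rw [div_le_iff₀ (by positivity)]; nlinarith
    have h2 : 0 < ε ^ 2 / (4 * t) := by positivity
    constructor <;> linarith
  have ρ_pos : ∀ t, 0 < t → 0 < ρ t := fun t ht => by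
    rcases le_total t (ε / 2) with h | h
    · rwa [ρ_le t h]
    · linarith [(ρ_ge' t h).1]
  have ρ_lt : ∀ t, ρ t < ε := fun t => by
    rcases le_total t (ε / 2) with h | h
    · rw [ρ_le t h]; linarith
    · exact (ρ_ge' t h).2
  have σρ : ∀ t, σ (ρ t) = t := fun t => by
    rcases le_total t (ε / 2) with h | h
    · rw [ρ_le t h, σ_le t h]
    · have : 0 < t := by linarith
      rw [σ_ge _ (ρ_ge' t h).1, ρ_ge t h, sub_sub_cancel]; field_simp
  have σ_ge' : ∀ t, t < ε → ε / 2 ≤ t → ε / 2 ≤ σ t := fun t h1 h2 => by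
    rw [σ_ge t h2, le_div_iff₀ (by linarith)]; nlinarith
  have ρσ : ∀ t, t < ε → ρ (σ t) = t := fun t h1 => by
    rcases le_total t (ε / 2) with h | h
    · rw [σ_le t h, ρ_le t h]
    · have : 0 < ε - t := by linarith
      rw [ρ_ge _ (σ_ge' t h1 h), σ_ge t h]; field_simp; ring
  -- from `ε` on the formula for `σ` gives no positive value; only its values on the ball matter
  let σ' : ℝ → ℝ := fun r => if r < ε then σ r else r
  have σ'_eq : ∀ r, r < ε → σ' r = σ r := fun r hr => if_pos hr
  have σ'_pos : ∀ t, 0 < t → 0 < σ' t := fun t ht => by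
    by_cases h : t < ε
    · rw [σ'_eq t h]
      rcases le_total t (ε / 2) with h' | h'
      · rwa [σ_le t h']
      · linarith [σ_ge' t h h']
    · simpa only [σ', if_neg h] using ht
  have σ'0 : σ' 0 = 0 := by rw [σ'_eq 0 hε, σ0]
  have ρ_cont : Continuous ρ := by
    refine (continuous_id.min continuous_const).add (continuous_const.sub
      (continuous_const.div (continuous_const.mul (continuous_id.max continuous_const)) ?_))
    intro t
    have := le_max_right t (ε / 2)
    exact (by linarith : 0 < 4 * max t (ε / 2)).ne'
  have σ'_cont : ∀ r, r < ε → ContinuousAt σ' r := fun r hr => by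
    have h1 : ContinuousAt σ r := by
      refine (continuousAt_id.min continuousAt_const).add (ContinuousAt.sub
        (continuousAt_const.div (continuousAt_const.mul
          (continuousAt_const.sub (continuousAt_id.max continuousAt_const))) ?_) continuousAt_const)
      have : max r (ε / 2) < ε := max_lt hr (by linarith)
      exact (by linarith : 0 < 4 * (ε - max r (ε / 2))).ne'
    refine h1.congr ?_
    filter_upwards [Iio_mem_nhds hr] with t ht
    exact (σ'_eq t ht).symm
  have hnorm : ∀ x : V, ‖radialMap ρ x‖ < ε := fun x => by
    rw [norm_radialMap ρ0 ρ_pos]; exact ρ_lt _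
  let e : OpenPartialHomeomorph V V :=
    { toFun := radialMap ρ
      invFun := radialMap σ'
      source := univ
      target := ball 0 ε
      map_source' := fun x _ => by simpa using hnorm x
      map_target' := fun _ _ => mem_univ _
      left_inv' := fun x _ => radialMap_radialMap ρ0 ρ_pos (by rw [σ'_eq _ (ρ_lt _), σρ])
      right_inv' := fun x hx => by
        have hx : ‖x‖ < ε := by simpa using hx
        exact radialMap_radialMap σ'0 σ'_pos (by rw [σ'_eq _ hx, ρσ _ hx])
      open_source := isOpen_univ
      open_target := isOpen_ball
      continuousOn_toFun := fun x _ =>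
        (continuousAt_radialMap ρ0 ρ_pos ρ_cont.continuousAt).continuousWithinAt
      continuousOn_invFun := fun x hx =>
        (continuousAt_radialMap σ'0 σ'_pos (σ'_cont _ (by simpa using hx))).continuousWithinAt }
  have he : IsOpenEmbedding (radialMap ρ : V → V) := e.isOpenEmbedding rfl
  have hr : range (radialMap ρ : V → V) = ball 0 ε := by
    rw [← image_univ]; exact e.image_source_eq_target
  refine ⟨fun x => a + radialMap ρ (x - a), ?_, ?_, ?_⟩
  · exact (Homeomorph.addLeft a).isOpenEmbedding.comp
      (he.comp (Homeomorph.subRight a).isOpenEmbedding)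
  · ext y
    constructor
    · rintro ⟨x, rfl⟩
      simpa [dist_eq_norm] using hnorm (x - a)
    · intro hy
      have : y - a ∈ range (radialMap ρ : V → V) := by
        rw [hr]; simpa [dist_eq_norm] using hy
      obtain ⟨x, hx⟩ := this
      exact ⟨x + a, by simp [hx]⟩
  · intro x hx
    have : ‖x - a‖ ≤ ε / 2 := by simpa [dist_eq_norm] using hx
    simp only
    rw [radialMap_eq_self (ρ_le _ this)]
    abel

/-- A large ball is shrunk into a small concentric one by a homeomorphism that is the identity far
away. -/
theorem exists_homeomorph_image_closedBall_subset {R η : ℝ} (hR : 0 < R) (hη : 0 < η) :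
    ∃ s : V ≃ₜ V, (∀ x ∈ closedBall (0 : V) R, s x ∈ ball (0 : V) η) ∧
      ∃ R' : ℝ, ∀ x, x ∉ closedBall (0 : V) R' → s x = x := by
  -- The norm is changed by a piecewise linear function of slopes `l`, `2 - l` and `1`, with breaks
  -- at `R` and at the fixed point `2 R`.
  obtain ⟨l, hl0, hl1, hlR⟩ : ∃ l : ℝ, 0 < l ∧ l < 1 ∧ l * R < η := by
    refine ⟨min (1 / 2) (η / (2 * R)), by positivity, ?_, ?_⟩
    · exact (min_le_left _ _).trans_lt (by norm_num)
    · have : min (1 / 2) (η / (2 * R)) * R ≤ η / (2 * R) * R :=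
        mul_le_mul_of_nonneg_right (min_le_right _ _) hR.le
      have h2 : η / (2 * R) * R = η / 2 := by field_simp
      linarith
  have hm : 0 < 2 - l := by linarith
  have hlR' : l * R < 2 * R := by nlinarith
  let ρ : ℝ → ℝ := fun t =>
    l * min t R + (2 - l) * (min (max t R) (2 * R) - R) + (max t (2 * R) - 2 * R)
  let σ : ℝ → ℝ := fun r =>
    l⁻¹ * min r (l * R) + (2 - l)⁻¹ * (min (max r (l * R)) (2 * R) - l * R) +
      (max r (2 * R) - 2 * R)
  have ρ1 : ∀ t, t ≤ R → ρ t = l * t := fun t ht => by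
    simp only [ρ, min_eq_left ht, max_eq_right ht, max_eq_right (by linarith : t ≤ 2 * R),
      min_eq_left (by linarith : R ≤ 2 * R)]; ring
  have ρ2 : ∀ t, R ≤ t → t ≤ 2 * R → ρ t = l * R + (2 - l) * (t - R) := fun t ht ht' => by
    simp only [ρ, min_eq_right ht, max_eq_left ht, max_eq_right ht', min_eq_left ht']; ring
  have ρ3 : ∀ t, 2 * R ≤ t → ρ t = t := fun t ht => by
    simp only [ρ, min_eq_right (by linarith : R ≤ t), max_eq_left (by linarith : R ≤ t),
      max_eq_left ht, min_eq_right ht]; ring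
  have σ1 : ∀ t, t ≤ l * R → σ t = l⁻¹ * t := fun t ht => by
    simp only [σ, min_eq_left ht, max_eq_right ht, max_eq_right (by linarith : t ≤ 2 * R),
      min_eq_left (by linarith : l * R ≤ 2 * R)]; ring
  have σ2 : ∀ t, l * R ≤ t → t ≤ 2 * R → σ t = R + (2 - l)⁻¹ * (t - l * R) := fun t ht ht' => by
    simp only [σ, min_eq_right ht, max_eq_left ht, max_eq_right ht', min_eq_left ht']
    field_simp; ring
  have σ3 : ∀ t, 2 * R ≤ t → σ t = t := fun t ht => by
    simp only [σ, min_eq_right (by linarith : l * R ≤ t), max_eq_left (by linarith : l * R ≤ t),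
      max_eq_left ht, min_eq_right ht]
    field_simp; ring
  have hσρ : ∀ t, σ (ρ t) = t ∧ (0 < t → 0 < ρ t) := fun t => by
    rcases le_total t R with h | h
    · rw [ρ1 t h, σ1 _ (by nlinarith)]
      exact ⟨by field_simp, fun h => by positivity⟩
    rcases le_total t (2 * R) with h' | h'
    · have h3 : 0 ≤ (2 - l) * (t - R) := mul_nonneg hm.le (by linarith)
      have h4 : (2 - l) * (t - R) ≤ (2 - l) * R := mul_le_mul_of_nonneg_left (by linarith) hm.le
      rw [ρ2 t h h', σ2 _ (by linarith) (by linarith)]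
      exact ⟨by field_simp; ring, fun h => by positivity⟩
    · rw [ρ3 t h', σ3 t h']; exact ⟨rfl, id⟩
  have hρσ : ∀ t, ρ (σ t) = t ∧ (0 < t → 0 < σ t) := fun t => by
    rcases le_total t (l * R) with h | h
    · have h5 : l⁻¹ * t ≤ R := by rw [inv_mul_le_iff₀ hl0]; exact h
      rw [σ1 t h, ρ1 _ h5]
      exact ⟨by field_simp, fun h => by positivity⟩
    rcases le_total t (2 * R) with h' | h'
    · have h3 : 0 ≤ (2 - l)⁻¹ * (t - l * R) := mul_nonneg (inv_pos.2 hm).le (by linarith)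
      have h4 : (2 - l)⁻¹ * (t - l * R) ≤ R := by rw [inv_mul_le_iff₀ hm]; linarith
      rw [σ2 t h h', ρ2 _ (by linarith) (by linarith)]
      exact ⟨by field_simp; ring, fun h => by positivity⟩
    · rw [σ3 t h', ρ3 t h']; exact ⟨rfl, id⟩
  have ρ0 : ρ 0 = 0 := by rw [ρ1 0 hR.le, mul_zero]
  have σ0 : σ 0 = 0 := by rw [σ1 0 (by positivity), mul_zero]
  have ρ_cont : Continuous ρ := by fun_prop
  have σ_cont : Continuous σ := by fun_prop
  refine ⟨{ toFun := radialMap ρ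
            invFun := radialMap σ
            left_inv := fun x => radialMap_radialMap ρ0 (fun t => (hσρ t).2) (hσρ _).1
            right_inv := fun x => radialMap_radialMap σ0 (fun t => (hρσ t).2) (hρσ _).1
            continuous_toFun := continuous_iff_continuousAt.2 fun x =>
              continuousAt_radialMap ρ0 (fun t => (hσρ t).2) ρ_cont.continuousAt
            continuous_invFun := continuous_iff_continuousAt.2 fun x =>
              continuousAt_radialMap σ0 (fun t => (hρσ t).2) σ_cont.continuousAt },
    fun x hx => ?_, 2 * R, fun x hx => ?_⟩
  · have hx : ‖x‖ ≤ R := by simpa using hx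
    have : ‖radialMap ρ x‖ < η := by
      rw [norm_radialMap ρ0 (fun t => (hσρ t).2), ρ1 _ hx]
      nlinarith
    simpa using this
  · have hx : 2 * R < ‖x‖ := by simpa using hx
    exact radialMap_eq_self (ρ3 _ hx.le)

end Radial

/-! ### Cellular sets and Brown's theorem -/

/-- A compactly supported self-map of `V` is carried over to the range of an open embedding of `V`
and extended by the identity. -/
theorem exists_continuous_extend_by_id {Y X : Type*} [TopologicalSpace Y] [TopologicalSpace X]
    [T2Space X] {φ : Y → X} (hφ : IsOpenEmbedding φ) {s : Y → Y} (hs : Continuous s) {K : Set Y}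
    (hK : IsCompact K) (hsK : ∀ x ∉ K, s x = x) :
    ∃ e : X → X, Continuous e ∧ (∀ x, e (φ x) = φ (s x)) ∧ ∀ y ∉ range φ, e y = y := by
  classical
  let e : X → X := fun x => if h : x ∈ range φ then φ (s h.choose) else x
  have he : ∀ x, e (φ x) = φ (s x) := fun x => by
    have h : φ x ∈ range φ := mem_range_self x
    have h' : h.choose = x := hφ.injective h.choose_spec
    simp only [e, dif_pos h, h']
  have he' : ∀ y ∉ range φ, e y = y := fun y hy => dif_neg hy
  refine ⟨e, continuous_iff_continuousAt.2 fun x => ?_, he, he'⟩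
  by_cases hx : x ∈ range φ
  · obtain ⟨y, rfl⟩ := hx
    rw [← hφ.continuousAt_iff]
    exact (continuous_congr (g := φ ∘ s) he).2 (hφ.continuous.comp hs) |>.continuousAt
  · have h1 : (φ '' K)ᶜ ∈ 𝓝 x := (hK.image hφ.continuous).isClosed.isOpen_compl.mem_nhds
      fun ⟨y, _, hy⟩ => hx ⟨y, hy⟩
    refine continuousAt_id.congr ?_
    filter_upwards [h1] with z hz
    by_cases hz' : z ∈ range φ
    · obtain ⟨y, rfl⟩ := hz'
      rw [he, hsK y fun hy => hz ⟨y, hy, rfl⟩]; rfl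
    · exact (he' z hz').symm

section Cellular

variable {V : Type*} [NormedAddCommGroup V] [NormedSpace ℝ V]

/-- Conjugation of a squeeze of the target by a map `H` that is not injective: the squeeze `g` of `V`
into a ball about `a` is lifted to a self-map `h` of the source. Only the fibre over `a` may be
large; over it `g` is the identity, and so is `h`. -/
theorem exists_conj_squeeze {X : Type*} [TopologicalSpace X] {H : X → V} (hH : Continuous H) {a : V}
    {δ : ℝ} (hδ : 0 < δ) (hrange : ball a δ ⊆ range H)
    (hinj : ∀ x y, H x ∈ ball a δ → H x = H y → H x ≠ a → x = y)
    (hclosed : ∀ y ∈ ball a δ, comap H (𝓝 y) ≤ 𝓝ˢ (H ⁻¹' {y})) :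
    ∃ (g : V → V) (h : X → X), IsOpenEmbedding g ∧ range g = ball a δ ∧ g a = a ∧ Continuous h ∧
      (∀ x, H (h x) = g (H x)) ∧ (∀ x, H (h x) ∈ ball a (δ / 2) → H x ∈ ball a (δ / 2)) ∧
      ∀ x, H x ∈ ball a (δ / 2) → h x = x := by
  obtain ⟨g, hg, hgr, hgid⟩ := exists_isOpenEmbedding_range_eq_ball a hδ
  have hgδ : ∀ y, g y ∈ ball a δ := fun y => hgr ▸ mem_range_self y
  have hga : g a = a := hgid a (mem_closedBall_self (by positivity))
  have hga' : ∀ y, g y = a → y = a := fun y hy => hg.injective (hy.trans hga.symm)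
  have hsub : ball a (δ / 2) ⊆ ball a δ := ball_subset_ball (by linarith)
  have hex : ∀ x, ∃ z, H z = g (H x) ∧ (H x = a → z = x) := fun x => by
    by_cases hx : H x = a
    · exact ⟨x, by rw [hx, hga], fun _ => rfl⟩
    · obtain ⟨z, hz⟩ := hrange (hgδ (H x))
      exact ⟨z, hz, fun h => absurd h hx⟩
  choose h hh1 hh2 using hex
  have hid : ∀ x, H x ∈ ball a (δ / 2) → h x = x := fun x hx => by
    by_cases hxa : H x = a
    · exact hh2 x hxa
    · have h1 : H (h x) = H x := by rw [hh1, hgid _ (ball_subset_closedBall hx)]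
      exact (hinj _ _ (hsub hx) h1.symm hxa).symm
  refine ⟨g, h, hg, hgr, hga, ?_, hh1, ?_, hid⟩
  · rw [continuous_iff_continuousAt]
    intro x
    by_cases hxa : H x = a
    · have : h =ᶠ[𝓝 x] id := by
        have : H ⁻¹' ball a (δ / 2) ∈ 𝓝 x :=
          (isOpen_ball.preimage hH).mem_nhds (by simp [hxa, hδ])
        filter_upwards [this] with y hy using hid y hy
      exact continuousAt_id.congr this.symm
    · have h1 : H ⁻¹' {H (h x)} = {h x} := by
        ext z
        constructor
        · intro hz
          refine (hinj (h x) z (hh1 x ▸ hgδ _) hz.symm fun h2 => hxa (hga' _ ?_)).symm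
          rw [← hh1, h2]
        · rintro rfl
          rfl
      have h2 := hclosed (H (h x)) (hh1 x ▸ hgδ _)
      rw [h1, nhdsSet_singleton] at h2
      refine Tendsto.mono_right ?_ h2
      rw [tendsto_comap_iff]
      have h3 : H ∘ h = g ∘ H := funext hh1
      rw [h3, hh1]
      exact (hg.continuous.comp hH).continuousAt
  · intro x hx
    have h1 : g (g (H x)) = g (H x) := hgid _ (ball_subset_closedBall (hh1 x ▸ hx))
    have h2 := hg.injective h1
    rwa [hh1, h2] at hx

/-- A subset of `V` is cellular if it has arbitrarily small neighborhoods that are open cells. -/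
def IsCellular (B : Set V) : Prop :=
  ∀ W : Set V, IsOpen W → B ⊆ W → ∃ φ : V → V, IsOpenEmbedding φ ∧ B ⊆ range φ ∧ range φ ⊆ W

/-- Brown's theorem: a continuous closed map of `V` onto itself with exactly two nondegenerate
fibres has cellular fibres. Conjugating a squeeze about the image of one of them gives a map `h` that
collapses only the other fibre, `B`, and takes values in `V`; conjugating by `h` the squeezes about
the point `h B` gives self-embeddings of `V` whose ranges shrink to `B`. -/
theorem isCellular_fiber_of_two {F : V → V} (hF : Continuous F) (hFc : IsClosedMap F)
    (hFs : Function.Surjective F) {a b : V} (hab : a ≠ b)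
    (hFi : ∀ x y, F x = F y → F x ≠ a → F x ≠ b → x = y) : IsCellular (F ⁻¹' {b}) := by
  have hδ : 0 < dist b a := dist_pos.2 hab.symm
  obtain ⟨g, h, hg, hgr, hga, hh, hFh, hhback, hhid⟩ := exists_conj_squeeze hF hδ
    (by rw [hFs.range_eq]; exact subset_univ _)
    (fun x y hx hxy hxa => hFi x y hxy hxa fun hxb => by simp [hxb] at hx)
    (fun y _ => hFc.comap_nhds_le)
  have hgb : ∀ y, g y ≠ b := fun y hy => by
    have : g y ∈ ball a (dist b a) := hgr ▸ mem_range_self y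
    simp [hy] at this
  have hga' : ∀ y, g y = a → y = a := fun y hy => hg.injective (hy.trans hga.symm)
  -- the fibres of `h`
  have hh_inj : ∀ x y, h x = h y → F x ≠ b → x = y := fun x y hxy hxb => by
    have h1 : F x = F y := hg.injective (by rw [← hFh, ← hFh, hxy])
    by_cases hxa : F x = a
    · rw [hhid x (by simp [hxa, hδ]), hhid y (by simp [← h1, hxa, hδ])] at hxy
      exact hxy
    · exact hFi x y h1 hxa hxb
  have hh_b : ∀ x y, F x = b → F y = b → h x = h y := fun x y hx hy => by
    refine hFi _ _ (by rw [hFh, hFh, hx, hy]) ?_ ?_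
    · rw [hFh, hx]; exact fun h2 => hab (hga' _ h2).symm
    · rw [hFh]; exact hgb _
  have hh_range : range h = F ⁻¹' range g := by
    ext z
    constructor
    · rintro ⟨x, rfl⟩
      exact ⟨F x, (hFh x).symm⟩
    · rintro ⟨y, hy⟩
      obtain ⟨w, rfl⟩ := hFs y
      by_cases hza : F z = a
      · exact ⟨z, hhid z (by simp [hza, hδ])⟩
      · exact ⟨w, hFi _ _ (by rw [hFh, hy]) (by rwa [hFh, hy]) (by rw [hFh]; exact hgb _)⟩
  have hh_comap : ∀ x, comap h (𝓝 (h x)) ≤ 𝓝ˢ (F ⁻¹' {F x}) := fun x =>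
    calc comap h (𝓝 (h x)) ≤ comap h (comap F (𝓝 (F (h x)))) :=
          comap_mono (hF.tendsto _).le_comap
      _ = comap F (comap g (𝓝 (g (F x)))) := by
          rw [comap_comap, comap_comap, hFh]; congr 1; exact funext hFh
      _ = comap F (𝓝 (F x)) := by rw [← hg.isInducing.nhds_eq_comap]
      _ ≤ _ := hFc.comap_nhds_le
  have hh_comap' : ∀ x, F x ≠ b → comap h (𝓝 (h x)) ≤ 𝓝 x := fun x hxb => by
    by_cases hxa : F x = a
    · rw [hhid x (by simp [hxa, hδ])]
      intro N hN
      refine ⟨N ∩ F ⁻¹' ball a (dist b a / 2), inter_mem hN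
        ((isOpen_ball.preimage hF).mem_nhds (by simp [hxa, hδ])), ?_⟩
      rintro z ⟨hz1, hz2⟩
      rwa [hhid z (hhback z hz2)] at hz1
    · have h1 : F ⁻¹' {F x} = {x} := by
        ext z
        exact ⟨fun hz => (hFi x z hz.symm hxa hxb).symm, fun hz => by rw [hz]; rfl⟩
      have h2 := hh_comap x
      rwa [h1, nhdsSet_singleton] at h2
  intro W hW hBW
  obtain ⟨x₀, hx₀⟩ := hFs b
  have hbne : ∀ x, h x = h x₀ ↔ F x = b := fun x =>
    ⟨fun hx => by_contra fun hxb => hxb (by rw [hh_inj x x₀ hx hxb, hx₀]),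
      fun hx => hh_b _ _ hx hx₀⟩
  -- all points near `h x₀` are values of `h`, come from points of `W`, and avoid the fibre over `a`
  have hev : ∀ᶠ y in 𝓝 (h x₀), y ∈ range h ∧ h ⁻¹' {y} ⊆ W ∧ F y ≠ a := by
    have h1 : range h ∈ 𝓝 (h x₀) := by
      rw [hh_range, hgr]
      refine (isOpen_ball.preimage hF).mem_nhds ?_
      rw [mem_preimage, hFh, ← hgr]
      exact mem_range_self _
    have h2 : ∀ᶠ y in 𝓝 (h x₀), h ⁻¹' {y} ⊆ W := by
      have h3 : W ∈ comap h (𝓝 (h x₀)) :=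
        hh_comap x₀ (hW.mem_nhdsSet.2 (by rw [hx₀]; exact hBW))
      obtain ⟨Y, hY, hYW⟩ := h3
      filter_upwards [hY] with y hy x hx
      exact hYW (by rw [mem_preimage, (hx : h x = y)]; exact hy)
    have h5 : ∀ᶠ y in 𝓝 (h x₀), F y ≠ a := by
      refine (hF.tendsto _).eventually (eventually_ne_nhds ?_)
      rw [hFh, hx₀]
      exact fun h6 => hab (hga' _ h6).symm
    filter_upwards [h1, h2, h5] with y h1 h2 h3 using ⟨h1, h2, h3⟩
  obtain ⟨δ, hδ', hball⟩ := Metric.eventually_nhds_iff_ball.1 hev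
  obtain ⟨g', φ, hg', hgr', hga'', hφ, hhφ, hback, hφid⟩ := exists_conj_squeeze hh hδ'
    (fun y hy => (hball y hy).1)
    (fun x y _ hxy hxb => hh_inj x y hxy fun h1 => hxb ((hbne x).2 h1))
    (fun y hy => by
      obtain ⟨x, rfl⟩ := (hball y hy).1
      have h1 : F x ≠ a := fun h1 => (hball _ hy).2.2 (by rw [hFh, h1, hga])
      refine (hh_comap x).trans (nhdsSet_mono ?_)
      intro z hz
      by_cases hxb : F x = b
      · exact hh_b _ _ (by rw [← hxb]; exact hz) hxb
      · have hz' : F z = F x := hz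
        have : z = x := hFi z x hz' (by rwa [hz']) (by rwa [hz'])
        simp [this])
  have hφB : ∀ x, F x = b → φ x = x := fun x hx =>
    hφid x (by rw [(hbne x).2 hx]; exact mem_ball_self (by positivity))
  have hφi : Function.Injective φ := fun x y hxy => by
    have h1 : h x = h y := hg'.injective (by rw [← hhφ, ← hhφ, hxy])
    by_cases hxb : F x = b
    · have hyb : F y = b := (hbne y).1 (h1 ▸ (hbne x).2 hxb)
      rwa [hφB x hxb, hφB y hyb] at hxy
    · exact hh_inj x y h1 hxb
  have hφr : range φ = h ⁻¹' (g' '' range h) := by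
    ext z
    constructor
    · rintro ⟨x, rfl⟩
      exact ⟨h x, mem_range_self x, (hhφ x).symm⟩
    · rintro ⟨_, ⟨x, rfl⟩, hx⟩
      rw [← hhφ] at hx
      by_cases hzb : F z = b
      · exact ⟨z, hφB z hzb⟩
      · exact ⟨x, (hh_inj z _ hx.symm hzb).symm⟩
  refine ⟨φ, ⟨⟨⟨?_⟩, hφi⟩, ?_⟩, fun x hx => ⟨x, hφB x hx⟩, ?_⟩
  · refine TopologicalSpace.ext_nhds fun x => ?_
    rw [nhds_induced]
    refine le_antisymm (hφ.tendsto _).le_comap ?_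
    by_cases hxb : F x = b
    · rw [hφB x hxb]
      intro N hN
      refine ⟨N ∩ h ⁻¹' ball (h x₀) (δ / 2), inter_mem hN
        ((isOpen_ball.preimage hh).mem_nhds ?_), ?_⟩
      · rw [mem_preimage, (hbne x).2 hxb]; exact mem_ball_self (by positivity)
      · rintro z ⟨hz1, hz2⟩
        rwa [hφid z (hback z hz2)] at hz1
    · calc comap φ (𝓝 (φ x)) ≤ comap φ (comap h (𝓝 (h (φ x)))) :=
            comap_mono (hh.tendsto _).le_comap
        _ = comap h (comap g' (𝓝 (g' (h x)))) := by
            rw [comap_comap, comap_comap, hhφ]; congr 1; exact funext hhφ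
        _ = comap h (𝓝 (h x)) := by rw [← hg'.isInducing.nhds_eq_comap]
        _ ≤ 𝓝 x := hh_comap' x hxb
  · rw [hφr, hh_range, hgr]
    exact (hg'.isOpenMap _ (isOpen_ball.preimage hF)).preimage hh
  · intro z hz
    rw [hφr] at hz
    obtain ⟨y, -, hy⟩ := hz
    exact (hball (h z) (by rw [← hy, ← hgr']; exact mem_range_self _)).2.1 rfl

/-- A homeomorphism `T` can be changed within a neighborhood `W` of a cellular compact set so that
some smaller neighborhood has small image: squeeze a cell in `W` towards its center first. -/
theorem IsCellular.exists_shrink [ProperSpace V] {B : Set V} (hB : IsCellular B)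
    (hBc : IsCompact B) {W : Set V} (hW : IsOpen W) (hBW : B ⊆ W) (T : V ≃ₜ V) {η : ℝ}
    (hη : 0 < η) :
    ∃ (T' : V ≃ₜ V) (W' : Set V), IsOpen W' ∧ B ⊆ W' ∧ closure W' ⊆ W ∧ W' ⊆ thickening η B ∧
      (∀ x ∉ W, T' x = T x) ∧ ∀ x ∈ W', ∀ y ∈ W', dist (T' x) (T' y) ≤ η := by
  obtain ⟨φ, hφ, hBφ, hφW⟩ := hB W hW hBW
  have hB' : IsCompact (φ ⁻¹' B) := hφ.isInducing.isCompact_preimage_iff hBφ |>.2 hBc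
  obtain ⟨R, hR0, hR⟩ : ∃ R : ℝ, 0 < R ∧ φ ⁻¹' B ⊆ ball 0 R := by
    obtain ⟨R, hR⟩ := hB'.isBounded.subset_ball 0
    exact ⟨max R 1, by positivity, hR.trans (ball_subset_ball (le_max_left _ _))⟩
  obtain ⟨ζ, hζ0, hζ⟩ := Metric.continuousAt_iff.1
    ((T.continuous.comp hφ.continuous).continuousAt (x := (0 : V))) (η / 2) (by positivity)
  obtain ⟨s, hs, R', hs'⟩ := exists_homeomorph_image_closedBall_subset (V := V) hR0 hζ0
  -- `s` carried over to the range of `φ` and extended by the identity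
  obtain ⟨e, he1, he2⟩ : ∃ e : V ≃ₜ V, (∀ x, e (φ x) = φ (s x)) ∧ ∀ y ∉ range φ, e y = y := by
    have hK := isCompact_closedBall (0 : V) R'
    obtain ⟨e, hec, he1, he2⟩ := exists_continuous_extend_by_id hφ s.continuous hK hs'
    obtain ⟨e', hec', he1', he2'⟩ := exists_continuous_extend_by_id hφ s.symm.continuous hK
      fun x hx => by rw [s.symm_apply_eq, hs' x hx]
    refine ⟨⟨⟨e, e', fun x => ?_, fun x => ?_⟩, hec, hec'⟩, he1, he2⟩
    · by_cases hx : x ∈ range φ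
      · obtain ⟨y, rfl⟩ := hx
        rw [he1, he1', s.symm_apply_apply]
      · rw [he2 x hx, he2' x hx]
    · by_cases hx : x ∈ range φ
      · obtain ⟨y, rfl⟩ := hx
        rw [he1', he1, s.apply_symm_apply]
      · rw [he2' x hx, he2 x hx]
  refine ⟨e.trans T, φ '' ball 0 R ∩ thickening η B,
    (hφ.isOpenMap _ isOpen_ball).inter isOpen_thickening, fun x hx => ?_, ?_, inter_subset_right,
    fun x hx => ?_, ?_⟩
  · obtain ⟨y, rfl⟩ := hBφ hx
    exact ⟨⟨y, hR hx, rfl⟩, self_subset_thickening hη B hx⟩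
  · have h1 : IsClosed (φ '' closedBall 0 R) :=
      ((isCompact_closedBall 0 R).image hφ.continuous).isClosed
    refine (closure_minimal (inter_subset_left.trans (image_mono ball_subset_closedBall)) h1).trans
      ((image_subset_range _ _).trans hφW)
  · rw [Homeomorph.trans_apply, he2 x fun h => hx (hφW h)]
  · rintro _ ⟨⟨x, hx, rfl⟩, -⟩ _ ⟨⟨y, hy, rfl⟩, -⟩
    have h1 := hζ (hs x (ball_subset_closedBall hx))
    have h2 := hζ (hs y (ball_subset_closedBall hy))
    simp only [Homeomorph.trans_apply, he1]
    have := dist_triangle_right (T (φ (s x))) (T (φ (s y))) (T (φ 0))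
    simp only [Function.comp_apply] at h1 h2
    linarith

/-- A nonempty cellular compact set can be collapsed to a point by a map of `V` that is injective
elsewhere and the identity far away, so that `V / B` is homeomorphic to `V`. The map is the uniform
limit of homeomorphisms shrinking ever smaller cell neighborhoods of `B`. -/
theorem IsCellular.exists_collapse [ProperSpace V] {B : Set V} (hB : IsCellular B)
    (hBc : IsCompact B) (hBn : B.Nonempty) :
    ∃ T : V → V, Continuous T ∧ Function.Surjective T ∧
      (∀ x y, T x = T y ↔ x = y ∨ x ∈ B ∧ y ∈ B) ∧
      ∃ K : Set V, IsCompact K ∧ ∀ x ∉ K, T x = x := by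
  obtain ⟨z, hz⟩ := hBn
  let State := {q : (V ≃ₜ V) × Set V // IsOpen q.2 ∧ B ⊆ q.2}
  have step : ∀ (k : ℕ) (q : State), ∃ q' : State, closure q'.1.2 ⊆ q.1.2 ∧
      q'.1.2 ⊆ thickening (1 / ((k : ℝ) + 1)) B ∧ (∀ x ∉ q.1.2, q'.1.1 x = q.1.1 x) ∧
      ∀ x ∈ q'.1.2, ∀ y ∈ q'.1.2, dist (q'.1.1 x) (q'.1.1 y) ≤ 1 / ((k : ℝ) + 1) := by
    rintro k ⟨⟨T, W⟩, hW, hBW⟩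
    obtain ⟨T', W', h1, h2, h3, h4, h5, h6⟩ := hB.exists_shrink hBc hW hBW T
      (η := 1 / ((k : ℝ) + 1)) (by positivity)
    exact ⟨⟨⟨T', W'⟩, h1, h2⟩, h3, h4, h5, h6⟩
  choose next hn1 hn2 hn3 hn4 using step
  obtain ⟨R, hR⟩ := hBc.isBounded.subset_ball (0 : V)
  let q : ℕ → State := fun k =>
    Nat.rec ⟨⟨Homeomorph.refl V, ball 0 R⟩, isOpen_ball, hR⟩ (fun k q => next k q) k
  let T : ℕ → V ≃ₜ V := fun k => (q k).1.1
  let W : ℕ → Set V := fun k => (q k).1.2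
  have hBW : ∀ k, B ⊆ W k := fun k => (q k).2.2
  have hcl : ∀ k, closure (W (k + 1)) ⊆ W k := fun k => hn1 k (q k)
  have hth : ∀ k, W (k + 1) ⊆ thickening (1 / ((k : ℝ) + 1)) B := fun k => hn2 k (q k)
  have hT : ∀ k, ∀ x ∉ W k, T (k + 1) x = T k x := fun k => hn3 k (q k)
  have hd : ∀ k, ∀ x ∈ W (k + 1), ∀ y ∈ W (k + 1), dist (T (k + 1) x) (T (k + 1) y) ≤
    1 / ((k : ℝ) + 1) := fun k => hn4 k (q k)
  have hanti : Antitone W := antitone_nat_of_succ_le fun k => subset_closure.trans (hcl k)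
  have hT' : ∀ k j, k ≤ j → ∀ x ∉ W k, T j x = T k x := fun k j hkj => by
    induction j, hkj using Nat.le_induction with
    | base => intros; rfl
    | succ j hkj ih => exact fun x hx => by rw [hT j x fun h => hx (hanti hkj h), ih x hx]
  -- bijections that agree off `W k` have the same image of `W k`
  have hTW : ∀ k j, k ≤ j → ∀ x ∈ W k, ∃ y ∈ W k, T k y = T j x := fun k j hkj x hx => by
    refine ⟨(T k).symm (T j x), by_contra fun h => h ?_, (T k).apply_symm_apply _⟩
    have h1 := hT' k j hkj _ h
    rw [(T k).apply_symm_apply] at h1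
    rwa [(T j).injective h1]
  have hdist : ∀ k j, k + 1 ≤ j → ∀ x, dist (T j x) (T (k + 1) x) ≤ 1 / ((k : ℝ) + 1) := by
    intro k j hkj x
    by_cases hx : x ∈ W (k + 1)
    · obtain ⟨y, hy, hyx⟩ := hTW _ _ hkj x hx
      rw [← hyx]
      exact hd k y hy x hx
    · rw [hT' _ _ hkj x hx, dist_self]; positivity
  have hcau : ∀ x, CauchySeq fun k => T k x := fun x => by
    refine Metric.cauchySeq_iff'.2 fun ε hε => ?_
    obtain ⟨k, hk⟩ := exists_nat_one_div_lt hε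
    exact ⟨k + 1, fun j hj => (hdist k j hj x).trans_lt hk⟩
  choose L hL using fun x => cauchySeq_tendsto_of_complete (hcau x)
  have hLd : ∀ k x, dist (L x) (T (k + 1) x) ≤ 1 / ((k : ℝ) + 1) := fun k x =>
    le_of_tendsto ((hL x).dist tendsto_const_nhds)
      (eventually_atTop.2 ⟨k + 1, fun j hj => hdist k j hj x⟩)
  have hLe : ∀ k, ∀ x ∉ W k, L x = T k x := fun k x hx =>
    tendsto_nhds_unique (hL x) (tendsto_const_nhds.congr'
      (eventually_atTop.2 ⟨k, fun j hj => (hT' k j hj x hx).symm⟩))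
  have hLW : ∀ k, ∀ x ∈ W k, ∃ y ∈ closure (W k), T k y = L x := fun k x hx => by
    have h1 : L x ∈ closure (T k '' W k) := mem_closure_of_tendsto (hL x)
      (eventually_atTop.2 ⟨k, fun j hj => hTW k j hj x hx⟩)
    rwa [← (T k).image_closure] at h1
  have hLc : Continuous L := by
    refine TendstoUniformly.continuous (F := fun k x => T (k + 1) x) (p := atTop) ?_
      (Frequently.of_forall fun k => (T (k + 1)).continuous)
    rw [Metric.tendstoUniformly_iff]
    intro ε hε
    obtain ⟨k, hk⟩ := exists_nat_one_div_lt hε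
    filter_upwards [eventually_ge_atTop k] with j hj x
    refine (hLd j x).trans_lt (lt_of_le_of_lt ?_ hk)
    gcongr
  -- a point that is close, for all `k`, to the values of `T (k + 1)` on `W (k + 1)` is the image of `B`
  have hclose : ∀ y, (∀ k, ∃ x ∈ W (k + 1), dist y (T (k + 1) x) ≤ 1 / ((k : ℝ) + 1)) →
      y = L z := fun y hy => by
    refine eq_of_forall_dist_le fun ε hε => ?_
    obtain ⟨k, hk⟩ := exists_nat_one_div_lt (show 0 < ε / 3 by positivity)
    obtain ⟨x, hx, hx'⟩ := hy k
    have h1 := hd k x hx z (hBW (k + 1) hz)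
    have h2 := hLd k z
    have h3 := dist_triangle4_right y (L z) (T (k + 1) x) (T (k + 1) z)
    linarith
  have hLB : ∀ x ∈ B, L x = L z := fun x hx => hclose _ fun k => ⟨x, hBW (k + 1) hx, hLd k x⟩
  have hBc' : ∀ x ∉ B, ∃ k, x ∉ closure (W k) := fun x hx => by
    have h1 : 0 < infDist x B := (hBc.isClosed.notMem_iff_infDist_pos ⟨z, hz⟩).1 hx
    obtain ⟨k, hk⟩ := exists_nat_one_div_lt h1
    refine ⟨k + 2, fun h => ?_⟩
    have h2 := (mem_thickening_iff_infDist_lt ⟨z, hz⟩).1 (hth k (hcl (k + 1) h))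
    linarith
  have hLi : ∀ x y, x ∉ B → L x = L y → x = y := fun x y hx hxy => by
    obtain ⟨k, hk⟩ := hBc' x hx
    have hk' : x ∉ W k := fun h => hk (subset_closure h)
    by_cases hy : y ∈ W k
    · obtain ⟨w, hw, hw'⟩ := hLW k y hy
      rw [hLe k x hk', ← hw'] at hxy
      exact absurd hw ((T k).injective hxy ▸ hk)
    · rw [hLe k x hk', hLe k y hy] at hxy
      exact (T k).injective hxy
  refine ⟨L, hLc, fun y => ?_, fun x y => ⟨fun hxy => ?_, ?_⟩, closedBall 0 R,
    isCompact_closedBall _ _, fun x hx => hLe 0 x fun h => hx (ball_subset_closedBall h)⟩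
  · by_cases h : ∃ k, (T k).symm y ∉ W k
    · obtain ⟨k, hk⟩ := h
      exact ⟨_, (hLe k _ hk).trans ((T k).apply_symm_apply y)⟩
    · push Not at h
      refine ⟨z, (hclose y fun k => ⟨_, h (k + 1), ?_⟩).symm⟩
      rw [(T (k + 1)).apply_symm_apply, dist_self]; positivity
  · by_cases hx : x ∈ B
    · by_cases hy : y ∈ B
      · exact Or.inr ⟨hx, hy⟩
      · exact Or.inl (hLi y x hy hxy.symm).symm
    · exact Or.inl (hLi x y hx hxy)
  · rintro (rfl | ⟨hx, hy⟩)
    · rfl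
    · rw [hLB x hx, hLB y hy]

/-- Brown's theorem for a compact space `S` all of whose one-point complements are open cells, that
is, for a sphere: if a map of `S` onto itself has just two nondegenerate fibres, then collapsing one
of them gives `S` back. -/
theorem exists_collapse_of_two_fibers [Nontrivial V] [ProperSpace V] {S : Type*}
    [TopologicalSpace S] [CompactSpace S] [T2Space S]
    (hS : ∀ x : S, ∃ j : V → S, IsOpenEmbedding j ∧ range j = {x}ᶜ) {f : S → S}
    (hf : Continuous f) (hfs : Function.Surjective f) {a b : S} (hab : a ≠ b)
    (hfi : ∀ x y, f x = f y → f x ≠ a → f x ≠ b → x = y) :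
    ∃ T : S → S, Continuous T ∧ Function.Surjective T ∧
      ∀ x y, T x = T y ↔ x = y ∨ f x = b ∧ f y = b := by
  -- remove a point with a one-point fibre from the source, and its image from the target
  obtain ⟨y₀, hya, hyb⟩ : ∃ y₀, y₀ ≠ a ∧ y₀ ≠ b := by
    obtain ⟨j, hj, hjr⟩ := hS b
    obtain ⟨v, hv⟩ : a ∈ range j := by rw [hjr]; exact hab
    obtain ⟨v', hv'⟩ := exists_ne v
    refine ⟨j v', fun h => hv' (hj.injective (h.trans hv.symm)), ?_⟩
    have : j v' ∈ range j := mem_range_self v'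
    rwa [hjr] at this
  obtain ⟨x₀, rfl⟩ := hfs y₀
  obtain ⟨j, hj, hjr⟩ := hS x₀
  obtain ⟨k, hk, hkr⟩ := hS (f x₀)
  have hjr' : ∀ x, x ∈ range j ↔ x ≠ x₀ := fun x => by rw [hjr]; rfl
  have hkr' : ∀ x, x ∈ range k ↔ x ≠ f x₀ := fun x => by rw [hkr]; rfl
  have hx₀ : ∀ x, f x = f x₀ → x = x₀ := fun x hx => (hfi x₀ x hx.symm hya hyb).symm
  have hex : ∀ v, ∃ w, k w = f (j v) := fun v =>
    (hkr' _).2 fun h => (hjr' (j v)).1 (mem_range_self v) (hx₀ _ h)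
  choose F hF using hex
  obtain ⟨a', rfl⟩ := (hkr' a).2 hya.symm
  obtain ⟨b', rfl⟩ := (hkr' b).2 hyb.symm
  have hFc : Continuous F := by
    rw [hk.isInducing.continuous_iff, show k ∘ F = f ∘ j from funext hF]
    exact hf.comp hj.continuous
  have hFcl : IsClosedMap F := fun C hC => by
    have h1 : IsClosed (insert x₀ (j '' C)) := by
      have h2 : (insert x₀ (j '' C))ᶜ = j '' Cᶜ := by
        ext x
        constructor
        · intro hx
          rw [mem_compl_iff, mem_insert_iff, not_or] at hx
          obtain ⟨v, rfl⟩ := (hjr' x).2 hx.1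
          exact ⟨v, fun hv => hx.2 ⟨v, hv, rfl⟩, rfl⟩
        · rintro ⟨v, hv, rfl⟩ hx
          rcases hx with hx | ⟨w, hw, hwv⟩
          · exact (hjr' _).1 (mem_range_self v) hx
          · exact hv (hj.injective hwv ▸ hw)
      rw [← isOpen_compl_iff, h2]
      exact hj.isOpenMap _ hC.isOpen_compl
    have h3 : F '' C = k ⁻¹' (f '' insert x₀ (j '' C)) := by
      ext w
      constructor
      · rintro ⟨v, hv, rfl⟩
        exact ⟨j v, Or.inr ⟨v, hv, rfl⟩, (hF v).symm⟩
      · rintro ⟨x, rfl | ⟨v, hv, rfl⟩, hx⟩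
        · exact absurd hx.symm ((hkr' _).1 (mem_range_self w))
        · exact ⟨v, hv, hk.injective ((hF v).trans hx)⟩
    rw [h3]
    exact (hf.isClosedMap _ h1).preimage hk.continuous
  have hFs : Function.Surjective F := fun w => by
    obtain ⟨x, hx⟩ := hfs (k w)
    obtain ⟨v, rfl⟩ := (hjr' x).2 fun h => (hkr' _).1 (mem_range_self w) (by rw [← hx, h])
    exact ⟨v, hk.injective ((hF v).trans hx)⟩
  have hab' : a' ≠ b' := fun h => hab (by rw [h])
  have hcell : IsCellular (F ⁻¹' {b'}) := isCellular_fiber_of_two hFc hFcl hFs hab'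
    fun x y hxy hxa hxb => hj.injective (hfi _ _ (by rw [← hF, ← hF, hxy])
      (fun h => hxa (hk.injective ((hF x).trans h))) fun h => hxb (hk.injective ((hF x).trans h)))
  have hFb : ∀ v, F v = b' ↔ f (j v) = k b' := fun v => by rw [← hF, hk.injective.eq_iff]
  have hcomp : IsCompact (F ⁻¹' {b'}) := by
    have h1 : F ⁻¹' {b'} = j ⁻¹' (f ⁻¹' {k b'}) := by
      ext v; exact hFb v
    rw [h1, hj.isInducing.isCompact_preimage_iff]
    · exact (isClosed_singleton.preimage hf).isCompact
    · intro x hx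
      exact (hjr' x).2 fun h => hyb (by rw [← h]; exact hx)
  obtain ⟨T, hT, hTs, hTi, K, hK, hTK⟩ := hcell.exists_collapse hcomp (hFs b')
  obtain ⟨e, he, he1, he2⟩ := exists_continuous_extend_by_id hj hT hK hTK
  have hex₀ : e x₀ = x₀ := he2 x₀ fun h => (hjr' _).1 h rfl
  have hne : ∀ v, e (j v) ≠ x₀ := fun v => by rw [he1]; exact (hjr' _).1 (mem_range_self _)
  refine ⟨e, he, fun x => ?_, fun x y => ?_⟩
  · by_cases hx : x = x₀
    · exact ⟨x₀, by rw [hex₀, hx]⟩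
    · obtain ⟨v, rfl⟩ := (hjr' x).2 hx
      obtain ⟨w, rfl⟩ := hTs v
      exact ⟨j w, he1 w⟩
  · by_cases hx : x = x₀
    · subst hx
      by_cases hy : y = x
      · simp [hy]
      · obtain ⟨v, rfl⟩ := (hjr' y).2 hy
        rw [hex₀]
        exact ⟨fun h => absurd h.symm (hne v), by
          rintro (h | h)
          · exact absurd h.symm hy
          · exact absurd h.1 hyb⟩
    · obtain ⟨v, rfl⟩ := (hjr' x).2 hx
      by_cases hy : y = x₀
      · subst hy
        rw [hex₀]
        exact ⟨fun h => absurd h (hne v), by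
          rintro (h | h)
          · exact absurd h hx
          · exact absurd h.2 hyb⟩
      · obtain ⟨w, rfl⟩ := (hjr' y).2 hy
        rw [he1, he1, hj.injective.eq_iff, hj.injective.eq_iff, hTi, ← hFb, ← hFb]
        rfl

end Cellular

/-! ### Lifting maps of the punctured space through coverings -/

section Lifting

variable {V : Type*} [NormedAddCommGroup V] [NormedSpace ℝ V]
  {E M : Type*} [TopologicalSpace E] [TopologicalSpace M]

theorem IsCoveringMap.exists_continuousOn_lift_of_starConvex {p : E → M} (hp : IsCoveringMap p)
    {U : Set V} (hU : IsOpen U) {v : V} (hv : StarConvex ℝ v U) {c : V → M} (hc : ContinuousOn c U)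
    {x₀ : V} (hx₀ : x₀ ∈ U) {y₀ : E} (hy₀ : p y₀ = c x₀) :
    ∃ l : V → E, ContinuousOn l U ∧ l x₀ = y₀ ∧ ∀ x ∈ U, p (l x) = c x := by
  classical
  have : ContractibleSpace U := hv.contractibleSpace ⟨x₀, hx₀⟩
  have : LocallyPathConnectedSpace U := hU.locallyPathConnectedSpace
  obtain ⟨F, ⟨hF1, hF2⟩, -⟩ := hp.existsUnique_continuousMap_lifts
    ⟨U.domRestrict c, continuousOn_iff_continuous_domRestrict.1 hc⟩ ⟨x₀, hx₀⟩ y₀ hy₀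
  have hl : ∀ x : U, (fun x : V => if h : x ∈ U then F ⟨x, h⟩ else y₀) x = F x := fun x => by
    simp
  refine ⟨fun x => if h : x ∈ U then F ⟨x, h⟩ else y₀, ?_, ?_, fun x hx => ?_⟩
  · rw [continuousOn_iff_continuous_domRestrict]
    exact F.continuous.congr fun x => (hl x).symm
  · exact (hl ⟨x₀, hx₀⟩).trans hF1
  · exact (congr_arg p (hl ⟨x, hx⟩)).trans (congr_fun hF2 ⟨x, hx⟩)

/-- The complement of the ray from the origin through `-v`. -/
def slitSpace (v : V) : Set V := ((fun t : ℝ => t • v) '' Iic 0)ᶜ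

theorem isOpen_slitSpace {v : V} (hv : v ≠ 0) : IsOpen (slitSpace v) :=
  ((isClosedEmbedding_smul_left hv).isClosedMap _ isClosed_Iic).isOpen_compl

theorem self_mem_slitSpace {v : V} (hv : v ≠ 0) : v ∈ slitSpace v := by
  rintro ⟨t, ht, h⟩
  have ht : t ≤ 0 := ht
  have h1 : (t - 1) • v = 0 := by rw [sub_smul, one_smul, sub_eq_zero]; exact h
  exact hv ((smul_eq_zero.1 h1).resolve_left (by linarith))

theorem starConvex_slitSpace {v : V} (hv : v ≠ 0) : StarConvex ℝ v (slitSpace v) := by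
  intro x hx a b ha hb hab
  rcases eq_or_lt_of_le hb with rfl | hb
  · have ha1 : a = 1 := by linarith
    rw [ha1, one_smul, zero_smul, add_zero]
    exact self_mem_slitSpace hv
  · rintro ⟨t, ht, h⟩
    have ht : t ≤ 0 := ht
    simp only at h
    refine hx ⟨b⁻¹ * (t - a), mem_Iic.2 (mul_nonpos_of_nonneg_of_nonpos (by positivity)
      (by linarith)), ?_⟩
    simp only
    rw [mul_smul, sub_smul, h, add_sub_cancel_left, smul_smul, inv_mul_cancel₀ hb.ne', one_smul]

/-- Maps from the punctured space lift through coverings in dimension at least three: it is the union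
of two star-shaped open sets with connected intersection. -/
theorem IsCoveringMap.exists_continuousOn_lift_compl_singleton {p : E → M} (hp : IsCoveringMap p)
    (hV : 2 < Module.rank ℝ V) {c : V → M} (hc : ContinuousOn c {0}ᶜ)
    {x₀ : V} (hx₀ : x₀ ≠ 0) {y₀ : E} (hy₀ : p y₀ = c x₀) :
    ∃ l : V → E, ContinuousOn l {0}ᶜ ∧ l x₀ = y₀ ∧ ∀ x, x ≠ 0 → p (l x) = c x := by
  classical
  have h0 : ∀ v : V, slitSpace v ⊆ {0}ᶜ := fun v x hx h => hx ⟨0, by simp, by simp [h.symm]⟩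
  have hx₀' : -x₀ ≠ 0 := neg_ne_zero.2 hx₀
  -- the two slit spaces cover the complement of the origin
  have hcov : ∀ x, x ≠ 0 → x ∈ slitSpace x₀ ∨ x ∈ slitSpace (-x₀) := fun x hx => by
    by_contra! h
    simp only [slitSpace, notMem_compl_iff] at h
    obtain ⟨⟨s, hs, hsx⟩, ⟨t, ht, htx⟩⟩ := h
    have hs : s ≤ 0 := hs
    have ht : t ≤ 0 := ht
    simp only at hsx htx
    have h1 : (s + t) • x₀ = 0 := by
      rw [add_smul, hsx, ← htx, smul_neg, neg_add_cancel]
    have h2 : s = 0 := by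
      have := (smul_eq_zero.1 h1).resolve_right hx₀
      linarith
    exact hx (by rw [← hsx, h2, zero_smul])
  -- and meet in the complement of a line
  have hint : slitSpace x₀ ∩ slitSpace (-x₀) = (Submodule.span ℝ {x₀} : Set V)ᶜ := by
    ext x
    simp only [slitSpace, mem_inter_iff, mem_compl_iff, SetLike.mem_coe,
      Submodule.mem_span_singleton, ← not_or]
    refine not_congr ⟨?_, ?_⟩
    · rintro (⟨t, -, rfl⟩ | ⟨t, -, rfl⟩)
      · exact ⟨t, rfl⟩
      · exact ⟨-t, by simp⟩
    · rintro ⟨t, rfl⟩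
      rcases le_total t 0 with h | h
      · exact Or.inl ⟨t, h, rfl⟩
      · exact Or.inr ⟨-t, by simpa using h, by simp⟩
  have hconn : IsConnected (slitSpace x₀ ∩ slitSpace (-x₀)) := by
    rw [hint]
    refine isConnected_compl_of_one_lt_codim ?_
    have h1 := Submodule.rank_quotient_add_rank (Submodule.span ℝ {x₀})
    have h2 : Module.rank ℝ (Submodule.span ℝ {x₀}) ≤ 1 := by
      simpa using rank_span_le (R := ℝ) {x₀}
    by_contra! h3
    have h4 := add_le_add h3 h2
    rw [h1, one_add_one_eq_two] at h4
    exact absurd hV (not_lt.2 h4)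
  have hmem : x₀ ∈ slitSpace x₀ := self_mem_slitSpace hx₀
  obtain ⟨l₁, hl₁, hl₁x, hl₁p⟩ := hp.exists_continuousOn_lift_of_starConvex (isOpen_slitSpace hx₀)
    (starConvex_slitSpace hx₀) (hc.mono (h0 _)) hmem hy₀
  obtain ⟨w, hw1, hw2⟩ := hconn.nonempty
  obtain ⟨l₂, hl₂, hl₂x, hl₂p⟩ := hp.exists_continuousOn_lift_of_starConvex (isOpen_slitSpace hx₀')
    (starConvex_slitSpace hx₀') (hc.mono (h0 _)) hw2 (hl₁p w hw1)
  have heq : EqOn l₁ l₂ (slitSpace x₀ ∩ slitSpace (-x₀)) :=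
    hp.eqOn_of_comp_eqOn hconn.isPreconnected (hl₁.mono inter_subset_left)
      (hl₂.mono inter_subset_right) (fun x hx => (hl₁p x hx.1).trans (hl₂p x hx.2).symm)
      ⟨hw1, hw2⟩ hl₂x.symm
  let l : V → E := fun x => if x ∈ slitSpace x₀ then l₁ x else l₂ x
  have e₁ : EqOn l l₁ (slitSpace x₀) := fun x hx => if_pos hx
  have e₂ : EqOn l l₂ (slitSpace (-x₀)) := fun x hx => by
    by_cases h : x ∈ slitSpace x₀
    · exact (e₁ h).trans (heq ⟨h, hx⟩)
    · exact if_neg h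
  refine ⟨l, ?_, (e₁ hmem).trans hl₁x, fun x hx => ?_⟩
  · exact ((hl₁.congr e₁).union_of_isOpen (hl₂.congr e₂) (isOpen_slitSpace hx₀)
      (isOpen_slitSpace hx₀')).mono hcov
  · rcases hcov x hx with h | h
    · rw [e₁ h, hl₁p x h]
    · rw [e₂ h, hl₂p x h]

end Lifting

/-! ### Collared spheres and their bounded sides -/

section Collar

variable {V : Type*} [NormedAddCommGroup V]

/-- A collared sphere in `X`: an open embedding of the punctured space `V \ {0}` into `X`; the image
of the unit sphere is the sphere. The value of `c` at `0` is irrelevant. -/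
def IsCollar {X : Type*} [TopologicalSpace X] (c : V → X) : Prop :=
  IsOpenEmbedding (({0}ᶜ : Set V).domRestrict c)

namespace IsCollar

variable {X : Type*} [TopologicalSpace X] {c : V → X}

theorem continuousOn (hc : IsCollar c) : ContinuousOn c {0}ᶜ :=
  continuousOn_iff_continuous_domRestrict.2 hc.continuous

theorem injOn (hc : IsCollar c) : InjOn c {0}ᶜ := injOn_iff_injective.2 hc.injective

theorem isOpen_image (hc : IsCollar c) {O : Set V} (hO : IsOpen O) (h0 : O ⊆ {0}ᶜ) :
    IsOpen (c '' O) := by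
  have : c '' O = ({0}ᶜ : Set V).domRestrict c '' (Subtype.val ⁻¹' O) := by
    rw [domRestrict_eq, image_comp, Subtype.image_preimage_coe, inter_eq_right.2 h0]
  rw [this]
  exact hc.isOpenMap _ (hO.preimage continuous_subtype_val)

theorem lift {Y : Type*} [TopologicalSpace Y] {p : Y → X} (hp : IsLocalHomeomorph p)
    (hc : IsCollar c) {l : V → Y} (hl : ContinuousOn l {0}ᶜ) (hlc : ∀ x, x ≠ 0 → p (l x) = c x) :
    IsCollar l := by
  refine hp.isOpenEmbedding_of_comp ?_ (continuousOn_iff_continuous_domRestrict.1 hl)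
  have : p ∘ ({0}ᶜ : Set V).domRestrict l = ({0}ᶜ : Set V).domRestrict c :=
    funext fun x => hlc x x.2
  rw [this]
  exact hc

end IsCollar

theorem sphere_subset_compl_zero : sphere (0 : V) 1 ⊆ {0}ᶜ := fun x hx h => by
  rw [mem_singleton_iff.1 h] at hx; simp at hx

theorem ne_zero_of_one_le_norm {x : V} (h : 1 ≤ ‖x‖) : x ≠ 0 := norm_pos_iff.1 (by linarith)

theorem IsCollar.isCompact_image_sphere [ProperSpace V] {X : Type*} [TopologicalSpace X] {c : V → X}
    (hc : IsCollar c) : IsCompact (c '' sphere 0 1) :=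
  (isCompact_sphere 0 1).image_of_continuousOn (hc.continuousOn.mono sphere_subset_compl_zero)

end Collar

section Separation

variable {V : Type*} [NormedAddCommGroup V] [NormedSpace ℝ V]

theorem isConnected_compl_closedBall (hV : 1 < Module.rank ℝ V) {r : ℝ} (hr : 0 ≤ r) :
    IsConnected (closedBall (0 : V) r)ᶜ := by
  have h1 : (closedBall (0 : V) r)ᶜ = (fun x : V => (1 + r / ‖x‖) • x) '' {0}ᶜ := by
    have hn : ∀ x : V, x ≠ 0 → ‖(1 + r / ‖x‖) • x‖ = ‖x‖ + r := fun x hx => by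
      have := norm_pos_iff.2 hx
      rw [norm_smul, Real.norm_of_nonneg (by positivity)]
      field_simp
    ext y
    constructor
    · intro hy
      have hy : r < ‖y‖ := by simpa using hy
      have hy0 : 0 < ‖y‖ := by linarith
      have h2 : 0 < 1 - r / ‖y‖ := by rw [sub_pos, div_lt_one hy0]; exact hy
      have h3 : ‖(1 - r / ‖y‖) • y‖ = ‖y‖ - r := by
        rw [norm_smul, Real.norm_of_nonneg h2.le]; field_simp
      have h4 : 0 < ‖y‖ - r := by linarith
      refine ⟨(1 - r / ‖y‖) • y, fun h => ?_, ?_⟩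
      · rw [mem_singleton_iff.1 h, norm_zero] at h3
        linarith
      · simp only [h3, smul_smul]
        have : (1 + r / (‖y‖ - r)) * (1 - r / ‖y‖) = 1 := by field_simp; ring
        rw [this, one_smul]
    · rintro ⟨x, hx, rfl⟩
      have := norm_pos_iff.2 (show x ≠ 0 from hx)
      simpa [hn x hx] using hx
  rw [h1]
  refine (isConnected_compl_singleton_of_one_lt_rank hV 0).image _ fun x hx => ?_
  exact ((continuousAt_const.add (continuousAt_const.div continuous_norm.continuousAt
    (norm_ne_zero_iff.2 hx))).smul continuousAt_id).continuousWithinAt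

/-- `U` is the bounded side of the collared sphere `l` in `V`. -/
structure IsInside (l : V → V) (U : Set V) : Prop where
  isOpen : IsOpen U
  isBounded : Bornology.IsBounded U
  disjoint : Disjoint U (l '' sphere 0 1)
  isClosed_union : IsClosed (U ∪ l '' sphere 0 1)
  sides : l '' {x | 1 < ‖x‖} ⊆ U ∧ Disjoint (l '' {x | x ≠ 0 ∧ ‖x‖ < 1}) U ∨
    l '' {x | x ≠ 0 ∧ ‖x‖ < 1} ⊆ U ∧ Disjoint (l '' {x | 1 < ‖x‖}) U

/-- A collared sphere separates `V`: crossing it once changes by `1` the lift to `ℝ` of the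
collapse map of `V` onto the circle that wraps the collar once around. -/
theorem IsCollar.exists_separating_function (hV : 1 < Module.rank ℝ V) {l : V → V}
    (hl : IsCollar l) [ProperSpace V] :
    ∃ F : V → ℝ, Continuous F ∧ (∀ y, F y = 1 / 2 ↔ y ∈ l '' sphere 0 1) ∧
      (∀ x, 1 < ‖x‖ → 1 / 2 < F (l x)) ∧ ∀ x, x ≠ 0 → ‖x‖ < 1 → F (l x) < 1 / 2 := by
  classical
  have hnt : Nontrivial V := rank_pos_iff_nontrivial.1 (one_pos.trans hV)
  let τ : V → ℝ := fun x => max 0 (min 1 (‖x‖ - 1 / 2))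
  have hτc : Continuous τ := by fun_prop
  let A : Set V := closedBall 0 (3 / 2) \ ball 0 (1 / 2)
  have hA : IsCompact A := (isCompact_closedBall _ _).diff isOpen_ball
  have hA0 : A ⊆ {0}ᶜ := fun x hx h => hx.2 (by rw [mem_singleton_iff.1 h]; simp)
  have hτA : ∀ x, x ∉ A → (τ x : AddCircle (1 : ℝ)) = 0 := fun x hx => by
    by_cases h : ‖x‖ < 1 / 2
    · have : τ x = 0 := max_eq_left ((min_le_right _ _).trans (by linarith))
      rw [this]; rfl
    · have h2 : 3 / 2 < ‖x‖ := by
        by_contra! h3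
        exact hx ⟨by simpa using h3, by simpa using h⟩
      have : τ x = 1 := by
        simp only [τ]
        rw [min_eq_left (by linarith), max_eq_right zero_le_one]
      rw [this]; exact AddCircle.coe_period 1
  -- the collapse map onto the circle
  let f : V → AddCircle (1 : ℝ) := fun y =>
    if h : ∃ x, x ≠ 0 ∧ l x = y then (τ h.choose : AddCircle (1 : ℝ)) else 0
  have hf1 : ∀ x, x ≠ 0 → f (l x) = τ x := fun x hx => by
    have h : ∃ x', x' ≠ 0 ∧ l x' = l x := ⟨x, hx, rfl⟩
    have h' : h.choose = x := hl.injOn h.choose_spec.1 hx h.choose_spec.2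
    simp only [f, dif_pos h, h']
  have hf2 : ∀ y ∉ l '' {0}ᶜ, f y = 0 := fun y hy => dif_neg hy
  have hfA : ∀ y ∉ l '' A, f y = 0 := fun y hy => by
    by_cases h : y ∈ l '' {0}ᶜ
    · obtain ⟨x, hx, rfl⟩ := h
      rw [hf1 x hx, hτA x fun hxA => hy ⟨x, hxA, rfl⟩]
    · exact hf2 y h
  have hfc : Continuous f := by
    rw [continuous_iff_continuousAt]
    intro y
    by_cases h : y ∈ l '' A
    · obtain ⟨x, hx, rfl⟩ := h
      have h1 := IsOpenEmbedding.continuousAt_iff (g := f) (x := ⟨x, hA0 hx⟩) hl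
      refine h1.1 (Continuous.continuousAt ?_)
      have h2 : f ∘ ({0}ᶜ : Set V).domRestrict l =
          fun z : ({0}ᶜ : Set V) => (τ z : AddCircle (1 : ℝ)) :=
        funext fun z => hf1 z z.2
      rw [h2]
      exact (AddCircle.isCoveringMap_coe (1 : ℝ)).continuous.comp
        (hτc.comp continuous_subtype_val)
    · have h1 : IsClosed (l '' A) := (hA.image_of_continuousOn (hl.continuousOn.mono hA0)).isClosed
      refine (continuousAt_const (y := (0 : AddCircle (1 : ℝ)))).congr ?_
      filter_upwards [h1.isOpen_compl.mem_nhds h] with z hz using (hfA z hz).symm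
  obtain ⟨u, hu⟩ : ∃ u : V, ‖u‖ = 1 := by simpa using exists_norm_eq V zero_le_one
  have hu0 : u ≠ 0 := norm_ne_zero_iff.1 (by rw [hu]; exact one_ne_zero)
  have hτ1 : τ u = 1 / 2 := by simp only [τ, hu]; norm_num
  obtain ⟨F, ⟨hF1, hF2⟩, -⟩ := (AddCircle.isCoveringMap_coe (1 : ℝ)).existsUnique_continuousMap_lifts
    ⟨f, hfc⟩ (l u) (1 / 2) (by rw [ContinuousMap.coe_mk, hf1 u hu0, hτ1])
  have hFl : EqOn (F ∘ l) τ {0}ᶜ := by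
    refine (AddCircle.isCoveringMap_coe (1 : ℝ)).eqOn_of_comp_eqOn
      (isConnected_compl_singleton_of_one_lt_rank hV 0).isPreconnected
      (F.continuous.comp_continuousOn hl.continuousOn) hτc.continuousOn (fun x hx => ?_)
      (show u ∈ ({0}ᶜ : Set V) from hu0) (by rw [Function.comp_apply, hF1, hτ1])
    exact (congr_fun hF2 (l x)).trans (hf1 x hx)
  refine ⟨F, F.continuous, fun y => ⟨fun hy => ?_, ?_⟩, fun x hx => ?_, fun x hx0 hx => ?_⟩
  · by_contra hyl
    by_cases h : y ∈ l '' {0}ᶜ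
    · obtain ⟨x, hx, rfl⟩ := h
      have h1 : τ x = 1 / 2 := (hFl hx).symm.trans hy
      refine hyl ⟨x, ?_, rfl⟩
      rw [mem_sphere_zero_iff_norm]
      simp only [τ] at h1
      grind
    · have h1 : ((F y : ℝ) : AddCircle (1 : ℝ)) = 0 := (congr_fun hF2 y).trans (hf2 y h)
      rw [hy, AddCircle.coe_eq_zero_iff] at h1
      obtain ⟨n, hn⟩ := h1
      rw [zsmul_eq_mul, mul_one] at hn
      have h2 : (2 * n : ℝ) = 1 := by linarith
      have h3 : 2 * n = 1 := by exact_mod_cast h2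
      omega
  · rintro ⟨x, hx, rfl⟩
    have h1 : F (l x) = τ x := hFl (sphere_subset_compl_zero hx)
    rw [h1]
    simp only [τ, mem_sphere_zero_iff_norm.1 hx]; norm_num
  · have h1 : F (l x) = τ x := hFl (show x ≠ 0 from norm_pos_iff.1 (by linarith))
    rw [h1]
    simp only [τ]
    grind
  · have h1 : F (l x) = τ x := hFl (show x ≠ 0 from hx0)
    rw [h1]
    simp only [τ]
    grind

theorem IsCollar.exists_isInside [ProperSpace V] (hV : 1 < Module.rank ℝ V) {l : V → V}
    (hl : IsCollar l) : ∃ U, IsInside l U := by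
  obtain ⟨F, hF, hFS, hF1, hF2⟩ := hl.exists_separating_function hV
  obtain ⟨R, hR⟩ := hl.isCompact_image_sphere.isBounded.subset_closedBall 0
  have hlt : IsOpen {y | F y < 1 / 2} := isOpen_lt hF continuous_const
  have hgt : IsOpen {y | 1 / 2 < F y} := isOpen_lt continuous_const hF
  have hle : {y | F y < 1 / 2} ∪ l '' sphere 0 1 = {y | F y ≤ 1 / 2} := by
    ext y; simp only [mem_union, mem_ofPred_eq, ← hFS, le_iff_lt_or_eq]
  have hge : {y | 1 / 2 < F y} ∪ l '' sphere 0 1 = {y | 1 / 2 ≤ F y} := by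
    ext y
    simp only [mem_union, mem_ofPred_eq, ← hFS, le_iff_lt_or_eq, eq_comm]
  -- the complement of a large ball is connected, so that it lies on one side
  have hfar : (closedBall (0 : V) (max R 0))ᶜ ⊆ {y | F y < 1 / 2} ∨
      (closedBall (0 : V) (max R 0))ᶜ ⊆ {y | 1 / 2 < F y} := by
    refine IsPreconnected.subset_or_subset hlt hgt ?_ ?_
      (isConnected_compl_closedBall hV (le_max_right _ _)).isPreconnected
    · exact disjoint_left.2 fun y (hy : F y < 1 / 2) (hy' : 1 / 2 < F y) => lt_asymm hy hy'
    · intro y hy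
      refine lt_or_gt_of_ne (a := F y) fun h => hy ?_
      exact closedBall_subset_closedBall (le_max_left _ _) (hR ((hFS y).1 h))
  have hbdd : ∀ s : Set V, (closedBall (0 : V) (max R 0))ᶜ ⊆ sᶜ → Bornology.IsBounded s :=
    fun s hs => isBounded_closedBall.subset (compl_subset_compl.1 hs)
  rcases hfar with hfar | hfar
  · refine ⟨{y | 1 / 2 < F y}, hgt, hbdd _ fun y hy (h : 1 / 2 < F y) =>
      lt_asymm h (hfar hy : F y < 1 / 2), ?_, ?_, Or.inl ⟨?_, ?_⟩⟩
    · exact disjoint_left.2 fun y hy hy' => ne_of_gt hy ((hFS y).2 hy')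
    · rw [hge]; exact isClosed_le continuous_const hF
    · rintro _ ⟨x, hx, rfl⟩; exact hF1 x hx
    · rw [disjoint_left]; rintro _ ⟨x, hx, rfl⟩ h; exact lt_asymm h (hF2 x hx.1 hx.2)
  · refine ⟨{y | F y < 1 / 2}, hlt, hbdd _ fun y hy (h : F y < 1 / 2) =>
      lt_asymm h (hfar hy : 1 / 2 < F y), ?_, ?_, Or.inr ⟨?_, ?_⟩⟩
    · exact disjoint_left.2 fun y hy hy' => ne_of_lt hy ((hFS y).2 hy')
    · rw [hle]; exact isClosed_le hF continuous_const
    · rintro _ ⟨x, hx, rfl⟩; exact hF2 x hx.1 hx.2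
    · rw [disjoint_left]; rintro _ ⟨x, hx, rfl⟩ h; exact lt_asymm h (hF1 x hx)

end Separation

/-! ### Innermost lifts of a collared sphere -/

section Innermost

/-- If a connected set `S` splits a connected space into `U` and the rest, then the rest together
with `S` is connected. -/
theorem isPreconnected_compl_of_isClosed_union {X : Type*} [TopologicalSpace X] [PreconnectedSpace X]
    {U S : Set X} (hU : IsOpen U) (hS : IsPreconnected S) (hUS : Disjoint U S)
    (hcl : IsClosed (U ∪ S)) : IsPreconnected Uᶜ := by
  have hSU : S ⊆ Uᶜ := fun x hx hxU => disjoint_left.1 hUS hxU hx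
  have key : ∀ A B : Set X, IsClosed A → IsClosed B → Uᶜ ⊆ A ∪ B → Uᶜ ∩ (A ∩ B) = ∅ → S ⊆ A →
      Uᶜ ⊆ A ∨ Uᶜ ⊆ B := fun A B hA hB hcov hd hSA => by
    have h1 : IsClosed (B ∩ Uᶜ) := hB.inter hU.isClosed_compl
    have h2 : (B ∩ Uᶜ)ᶜ = (U ∪ S) ∪ (A ∩ Uᶜ) := by
      ext x
      constructor
      · intro hx
        by_cases hxU : x ∈ U
        · exact Or.inl (Or.inl hxU)
        · exact Or.inr ⟨(hcov hxU).resolve_right fun h => hx ⟨h, hxU⟩, hxU⟩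
      · rintro ((hx | hx) | hx) hxB
        · exact hxB.2 hx
        · exact (hd ▸ (⟨hSU hx, hSA hx, hxB.1⟩ : x ∈ Uᶜ ∩ (A ∩ B)) : x ∈ (∅ : Set X))
        · exact (hd ▸ (⟨hx.2, hx.1, hxB.1⟩ : x ∈ Uᶜ ∩ (A ∩ B)) : x ∈ (∅ : Set X))
    have h3 : IsOpen (B ∩ Uᶜ) := by
      rw [← isClosed_compl_iff, h2]
      exact hcl.union (hA.inter hU.isClosed_compl)
    rcases isClopen_iff.1 ⟨h1, h3⟩ with h | h
    · left
      intro x hx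
      exact (hcov hx).resolve_right fun hxB => by
        have : x ∈ B ∩ Uᶜ := ⟨hxB, hx⟩
        rwa [h] at this
    · right
      intro x _
      have : x ∈ B ∩ Uᶜ := h ▸ mem_univ x
      exact this.1
  rw [isPreconnected_iff_subset_of_disjoint_closed]
  intro A B hA hB hcov hd
  have hSd : S ∩ (A ∩ B) = ∅ := subset_empty_iff.1 (hd ▸ inter_subset_inter_left _ hSU)
  rcases isPreconnected_iff_subset_of_disjoint_closed.1 hS A B hA hB (hSU.trans hcov) hSd with h | h
  · exact key A B hA hB hcov hd h
  · exact (key B A hB hA (by rwa [union_comm]) (by rwa [inter_comm B A]) h).symm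

variable {V : Type*} [NormedAddCommGroup V] {M : Type*} {p : V → M} {c : V → M}

/-- `l` is a lift of `c` through `p` over the punctured space. -/
structure IsPuncturedLift (p : V → M) (c : V → M) (l : V → V) : Prop where
  continuousOn : ContinuousOn l {0}ᶜ
  map_eq : ∀ x, x ≠ 0 → p (l x) = c x

variable [NormedSpace ℝ V] [TopologicalSpace M]

theorem IsPuncturedLift.eqOn (hp : IsCoveringMap p) (hV : 1 < Module.rank ℝ V) {l l' : V → V}
    (h : IsPuncturedLift p c l) (h' : IsPuncturedLift p c l') {x : V} (hx : x ≠ 0)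
    (hxx : l x = l' x) : EqOn l l' {0}ᶜ :=
  hp.eqOn_of_comp_eqOn (isConnected_compl_singleton_of_one_lt_rank hV 0).isPreconnected
    h.continuousOn h'.continuousOn (fun y hy => (h.map_eq y hy).trans (h'.map_eq y hy).symm)
    (show x ∈ ({0}ᶜ : Set V) from hx) hxx

variable [ProperSpace V]

/-- If the bounded side of a lifted sphere meets another lift, the bounded side of that one is
smaller. -/
theorem exists_inside_subset (hV : 2 < Module.rank ℝ V) (hp : IsCoveringMap p)
    (hc : IsCollar c) {l : V → V} (hl : IsPuncturedLift p c l) {U : Set V} (hU : IsInside l U)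
    {x y : V} (hy : y ∈ U) (hx : x ∈ sphere (0 : V) 1) (hyx : p y = c x) :
    ∃ l' U', IsPuncturedLift p c l' ∧ IsInside l' U' ∧ U' ⊆ U ∧ l' '' sphere 0 1 ⊆ U := by
  have hV1 : 1 < Module.rank ℝ V := lt_trans (by norm_num) hV
  have hnt : Nontrivial V := rank_pos_iff_nontrivial.1 (one_pos.trans hV1)
  have hx0 : x ≠ 0 := sphere_subset_compl_zero hx
  obtain ⟨l', hl'1, hl'x, hl'2⟩ := hp.exists_continuousOn_lift_compl_singleton hV hc.continuousOn
    hx0 hyx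
  have hl' : IsPuncturedLift p c l' := ⟨hl'1, hl'2⟩
  have hlc' : IsCollar l' := hc.lift hp.isLocalHomeomorph hl'1 hl'2
  have hlc : IsCollar l := hc.lift hp.isLocalHomeomorph hl.continuousOn hl.map_eq
  obtain ⟨U', hU'⟩ := hlc'.exists_isInside hV1
  have hdisj : Disjoint (l '' sphere 0 1) (l' '' sphere 0 1) := by
    rw [disjoint_left]
    rintro _ ⟨w, hw, rfl⟩ ⟨z, hz, hzw⟩
    have hw0 := sphere_subset_compl_zero hw
    have hz0 := sphere_subset_compl_zero hz
    have h1 : z = w := hc.injOn hz0 hw0 (by rw [← hl'2 z hz0, ← hl.map_eq w hw0, hzw])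
    subst h1
    have h2 := hl'.eqOn hp hV1 hl hz0 hzw hx0
    exact disjoint_left.1 hU.disjoint hy ⟨x, hx, by rw [← h2, hl'x]⟩
  have hpre : ∀ {m : V → V}, IsCollar m → IsPreconnected (m '' sphere 0 1) := fun hm =>
    (isPreconnected_sphere hV1 0 1).image _ (hm.continuousOn.mono sphere_subset_compl_zero)
  have hS' : l' '' sphere 0 1 ⊆ U := by
    refine (hpre hlc').subset_left_of_subset_union hU.isOpen hU.isClosed_union.isOpen_compl
      (disjoint_left.2 fun z hz hz' => hz' (Or.inl hz)) (fun z hz => ?_)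
      ⟨y, ⟨x, hx, hl'x⟩, hy⟩
    by_cases hzU : z ∈ U
    · exact Or.inl hzU
    · exact Or.inr fun h => h.elim hzU fun h => disjoint_left.1 hdisj h hz
  refine ⟨l', U', hl', hU', ?_, hS'⟩
  have hcompl : IsPreconnected Uᶜ := isPreconnected_compl_of_isClosed_union hU.isOpen (hpre hlc)
    hU.disjoint hU.isClosed_union
  rcases hcompl.subset_or_subset hU'.isOpen hU'.isClosed_union.isOpen_compl
    (disjoint_left.2 fun z hz hz' => hz' (Or.inl hz)) (fun z hz => by
      by_cases hzU : z ∈ U'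
      · exact Or.inl hzU
      · exact Or.inr fun h => h.elim hzU fun h => hz (hS' h)) with h | h
  · -- `Uᶜ` is unbounded
    have h1 : Bornology.IsBounded (univ : Set V) := by
      rw [← union_compl_self U]
      exact hU.isBounded.union (hU'.isBounded.subset h)
    exact absurd h1 (NormedSpace.unbounded_univ ℝ V)
  · exact fun z hz => by_contra fun hzU => h hzU (Or.inl hz)

/-- Among the lifts of a collared sphere there is an innermost one, whose bounded side meets no
lift: only finitely many lifts meet a given compact set, as fibres of a covering are discrete. -/
theorem exists_innermost_lift [T2Space M] (hV : 2 < Module.rank ℝ V) (hp : IsCoveringMap p)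
    (hps : Function.Surjective p) (hc : IsCollar c) :
    ∃ l U, IsPuncturedLift p c l ∧ IsInside l U ∧ ∀ y ∈ U, ∀ x ∈ sphere (0 : V) 1, p y ≠ c x := by
  have hV1 : 1 < Module.rank ℝ V := lt_trans (by norm_num) hV
  have hnt : Nontrivial V := rank_pos_iff_nontrivial.1 (one_pos.trans hV1)
  obtain ⟨u, hu⟩ : ∃ u : V, u ∈ sphere (0 : V) 1 := by simpa using exists_norm_eq V zero_le_one
  have hu0 : u ≠ 0 := sphere_subset_compl_zero hu
  have hfin : ∀ U : Set V, Bornology.IsBounded U → (U ∩ p ⁻¹' {c u}).Finite := fun U hU => by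
    have h1 : IsCompact (closure U ∩ p ⁻¹' {c u}) :=
      hU.isCompact_closure.inter_right (isClosed_singleton.preimage hp.continuous)
    have h2 : IsDiscrete (p ⁻¹' {c u}) := ⟨(hp (c u)).discreteTopology_fiber⟩
    exact (h1.finite (h2.mono inter_subset_right)).subset
      (inter_subset_inter_left _ subset_closure)
  have key : ∀ (n : ℕ) (l : V → V) (U : Set V), IsPuncturedLift p c l → IsInside l U →
      (U ∩ p ⁻¹' {c u}).ncard = n →
      ∃ l U, IsPuncturedLift p c l ∧ IsInside l U ∧
        ∀ y ∈ U, ∀ x ∈ sphere (0 : V) 1, p y ≠ c x := by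
    intro n
    induction n using Nat.strong_induction_on with
    | _ n ih =>
      intro l U hl hU hn
      by_cases h : ∀ y ∈ U, ∀ x ∈ sphere (0 : V) 1, p y ≠ c x
      · exact ⟨l, U, hl, hU, h⟩
      · push Not at h
        obtain ⟨y, hy, x, hx, hyx⟩ := h
        obtain ⟨l', U', hl', hU', hsub, hS'⟩ := exists_inside_subset hV hp hc hl hU hy hx hyx
        refine ih _ ?_ l' U' hl' hU' rfl
        rw [← hn]
        refine ncard_lt_ncard (ssubset_iff_subset_ne.2 ⟨inter_subset_inter_left _ hsub, ?_⟩)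
          (hfin U hU.isBounded)
        intro heq
        have h1 : l' u ∈ U ∩ p ⁻¹' {c u} := ⟨hS' ⟨u, hu, rfl⟩, hl'.map_eq u hu0⟩
        rw [← heq] at h1
        exact disjoint_left.1 hU'.disjoint h1.1 ⟨u, hu, rfl⟩
  obtain ⟨y, hy⟩ := hps (c u)
  obtain ⟨l, hl1, -, hl2⟩ := hp.exists_continuousOn_lift_compl_singleton hV hc.continuousOn hu0 hy
  have hlc : IsCollar l := hc.lift hp.isLocalHomeomorph hl1 hl2
  obtain ⟨U, hU⟩ := hlc.exists_isInside hV1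
  exact key _ l U ⟨hl1, hl2⟩ hU rfl

end Innermost

/-! ### The innermost region covers a punctured summand once -/

section Innermost

variable {V : Type*} [NormedAddCommGroup V] {M : Type*}

/-- The lift `l` of the collar `c` has a bounded side `U` that meets no other lift of the sphere, and
the outer part of the collar runs into it. -/
structure IsInnermost (p : V → M) (c : V → M) (l : V → V) (U : Set V) : Prop
    extends IsPuncturedLift p c l where
  isOpen : IsOpen U
  isBounded : Bornology.IsBounded U
  disjoint : Disjoint U (l '' sphere 0 1)
  isClosed_union : IsClosed (U ∪ l '' sphere 0 1)
  outer_subset : l '' {x | 1 < ‖x‖} ⊆ U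
  inner_disjoint : Disjoint (l '' {x | x ≠ 0 ∧ ‖x‖ < 1}) U
  map_ne : ∀ y ∈ U, ∀ x ∈ sphere (0 : V) 1, p y ≠ c x

variable {p : V → M} {c : V → M} {l : V → V} {U : Set V}

namespace IsInnermost

theorem one_le_norm (h : IsInnermost p c l U) {x : V} (hx : x ≠ 0) (hU : l x ∈ U ∪ l '' sphere 0 1)
    (hl : InjOn l {0}ᶜ) : 1 ≤ ‖x‖ := by
  by_contra! h1
  rcases hU with hU | ⟨w, hw, hwx⟩
  · exact disjoint_left.1 h.inner_disjoint ⟨x, ⟨hx, h1⟩, rfl⟩ hU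
  · have h2 : w = x := hl (sphere_subset_compl_zero hw) hx hwx
    rw [← h2, mem_sphere_zero_iff_norm.1 hw] at h1
    exact lt_irrefl _ h1

theorem mem_union (h : IsInnermost p c l U) {x : V} (hx : 1 ≤ ‖x‖) :
    l x ∈ U ∪ l '' sphere 0 1 := by
  rcases hx.lt_or_eq with hx | hx
  · exact Or.inl (h.outer_subset ⟨x, hx, rfl⟩)
  · exact Or.inr ⟨x, by simpa using hx.symm, rfl⟩

theorem isCompact_union [ProperSpace V] (h : IsInnermost p c l U) (hl : IsCollar l) :
    IsCompact (U ∪ l '' sphere 0 1) :=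
  Metric.isCompact_of_isClosed_isBounded h.isClosed_union
    (h.isBounded.union hl.isCompact_image_sphere.isBounded)

end IsInnermost

theorem eq_empty_of_isClopen_of_isBounded [NormedSpace ℝ V] [Nontrivial V] {A : Set V}
    (hA : IsClopen A) (hb : Bornology.IsBounded A) : A = ∅ :=
  (isClopen_iff.1 hA).resolve_right fun h => NormedSpace.unbounded_univ ℝ V (h ▸ hb)

end Innermost

section Side

variable {V : Type*} [NormedAddCommGroup V] {M M₁ : Type*} [TopologicalSpace M]
  [TopologicalSpace M₁]

/-- The collared sphere `c` bounds in `M` a copy of the manifold `M₁` with the open ball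
`e '' ball 0 1` removed, embedded by `i`; on the side of `M₁` the collar is that given by `e`. -/
structure IsSide (e : V → M₁) (i : ((e '' ball 0 1)ᶜ : Set M₁) → M) (c : V → M) : Prop where
  isOpenEmbedding : IsOpenEmbedding e
  isClosedEmbedding : IsClosedEmbedding i
  isCollar : IsCollar c
  isOpen_interior : IsOpen (range i \ c '' sphere 0 1)
  collar_eq : ∀ (x : V) (a : ((e '' ball 0 1)ᶜ : Set M₁)), 1 ≤ ‖x‖ → (a : M₁) = e x → c x = i a
  collar_notMem : ∀ x, x ≠ 0 → ‖x‖ < 1 → c x ∉ range i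

variable {e : V → M₁} {i : ((e '' ball 0 1)ᶜ : Set M₁) → M} {c : V → M} {p : V → M} {l : V → V}
  {U : Set V}

theorem IsSide.mem_compl_image_ball (h : IsSide e i c) {x : V} :
    e x ∈ (e '' ball 0 1)ᶜ ↔ 1 ≤ ‖x‖ := by
  rw [mem_compl_iff, h.isOpenEmbedding.injective.mem_set_image, mem_ball_zero_iff, not_lt]

theorem IsSide.collar_mem (h : IsSide e i c) {x : V} (hx : 1 ≤ ‖x‖) : c x ∈ range i :=
  ⟨⟨e x, h.mem_compl_image_ball.2 hx⟩, (h.collar_eq x _ hx rfl).symm⟩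

namespace IsInnermost

variable [NormedSpace ℝ V] [Nontrivial V]

/-- The innermost region lies over the summand whose collar runs into it. -/
theorem map_mem_range (h : IsInnermost p c l U) (hs : IsSide e i c) (hl : IsCollar l)
    (hp : Continuous p) {y : V} (hy : y ∈ U ∪ l '' sphere 0 1) : p y ∈ range i := by
  have hG : IsClopen (U ∩ p ⁻¹' (range i)ᶜ) := by
    refine ⟨?_, h.isOpen.inter (hs.isClosedEmbedding.isClosed_range.isOpen_compl.preimage hp)⟩
    rw [← isOpen_compl_iff, isOpen_iff_mem_nhds]
    intro z hz
    by_cases hzD : z ∈ U ∪ l '' sphere 0 1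
    · rcases hzD with hzU | ⟨x, hx, rfl⟩
      · have hzi : p z ∈ range i := by_contra fun h1 => hz ⟨hzU, h1⟩
        have h2 : p z ∈ range i \ c '' sphere 0 1 :=
          ⟨hzi, fun ⟨x, hx, hxz⟩ => h.map_ne z hzU x hx hxz.symm⟩
        filter_upwards [(hs.isOpen_interior.preimage hp).mem_nhds h2] with w hw hwG
        exact hwG.2 hw.1
      · filter_upwards [(hl.isOpen_image isOpen_compl_singleton Subset.rfl).mem_nhds
          ⟨x, sphere_subset_compl_zero hx, rfl⟩] with w hw hwG
        obtain ⟨x', hx', rfl⟩ := hw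
        have h1 := h.one_le_norm hx' (Or.inl hwG.1) hl.injOn
        exact hwG.2 (by rw [h.map_eq x' hx']; exact hs.collar_mem h1)
    · filter_upwards [h.isClosed_union.isOpen_compl.mem_nhds hzD] with w hw hwG
      exact hw (Or.inl hwG.1)
  have hG0 := eq_empty_of_isClopen_of_isBounded hG (h.isBounded.subset inter_subset_left)
  rcases hy with hy | ⟨x, hx, rfl⟩
  · by_contra h1
    exact (hG0 ▸ (⟨hy, h1⟩ : y ∈ U ∩ p ⁻¹' (range i)ᶜ) : y ∈ (∅ : Set V))
  · rw [h.map_eq x (sphere_subset_compl_zero hx)]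
    exact hs.collar_mem (mem_sphere_zero_iff_norm.1 hx).ge

variable [ProperSpace V]

/-- The covering is injective on the closure of the innermost region: the set of points that
share their image with another one is open and closed, as it does not meet the boundary. -/
theorem injOn_union [T2Space M] (h : IsInnermost p c l U) (hc : IsCollar c) (hl : IsCollar l)
    (hp : IsLocalHomeomorph p) : InjOn p (U ∪ l '' sphere 0 1) := by
  have hp' := hp.continuous
  let D := U ∪ l '' sphere 0 1
  let Z : Set (V × V) := (D ×ˢ D) ∩ {q | p q.1 = p q.2 ∧ q.1 ≠ q.2}
  have hZc : IsClosed {q : V × V | p q.1 = p q.2 ∧ q.1 ≠ q.2} := by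
    rw [← isOpen_compl_iff, isOpen_iff_mem_nhds]
    rintro ⟨y, y'⟩ hq
    by_cases hpp : p y = p y'
    · have hyy : y = y' := by_contra fun h1 => hq ⟨hpp, h1⟩
      subst hyy
      obtain ⟨f, hf, rfl⟩ := hp y
      filter_upwards [prod_mem_nhds (f.open_source.mem_nhds hf) (f.open_source.mem_nhds hf)]
        with q hq hq'
      exact hq'.2 (f.injOn hq.1 hq.2 hq'.1)
    · have h1 : IsOpen {q : V × V | p q.1 ≠ p q.2} :=
        isOpen_ne_fun (hp'.comp continuous_fst) (hp'.comp continuous_snd)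
      filter_upwards [h1.mem_nhds hpp] with q hq hq'
      exact hq hq'.1
  have hZ : IsCompact Z := ((h.isCompact_union hl).prod (h.isCompact_union hl)).inter_right hZc
  let A := Prod.fst '' Z
  have hAcl : IsClosed A := (hZ.image continuous_fst).isClosed
  have hAD : A ⊆ D := by
    rintro _ ⟨q, hq, rfl⟩; exact hq.1.1
  have hZU : ∀ q ∈ Z, q.1 ∈ U ∧ q.2 ∈ U := by
    rintro ⟨y, y'⟩ ⟨⟨hy, hy'⟩, hpp, hne⟩
    simp only at hy hy' hpp hne ⊢
    rcases hy with hy | ⟨x, hx, rfl⟩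
    · rcases hy' with hy' | ⟨x', hx', rfl⟩
      · exact ⟨hy, hy'⟩
      · exact absurd (hpp.trans (h.map_eq x' (sphere_subset_compl_zero hx')))
          (h.map_ne y hy x' hx')
    · have hx0 := sphere_subset_compl_zero hx
      rw [h.map_eq x hx0] at hpp
      rcases hy' with hy' | ⟨x', hx', rfl⟩
      · exact absurd hpp.symm (h.map_ne y' hy' x hx)
      · have hx0' := sphere_subset_compl_zero hx'
        rw [h.map_eq x' hx0'] at hpp
        exact absurd (by rw [hc.injOn hx0 hx0' hpp]) hne
  have hAop : IsOpen A := by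
    rw [isOpen_iff_mem_nhds]
    rintro _ ⟨⟨y, y'⟩, hq, rfl⟩
    have hqU := hZU _ hq
    obtain ⟨O, O', hO, hO', hyO, hyO', hd⟩ := t2_separation hq.2.2
    have h1 : IsOpen (p '' (O' ∩ U)) := hp.isOpenMap _ (hO'.inter h.isOpen)
    have h2 : p y ∈ p '' (O' ∩ U) := ⟨y', ⟨hyO', hqU.2⟩, hq.2.1.symm⟩
    filter_upwards [hO.mem_nhds hyO, h.isOpen.mem_nhds hqU.1, (h1.preimage hp').mem_nhds h2]
      with w hwO hwU hw
    obtain ⟨w', hw', hww⟩ := hw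
    exact ⟨(w, w'), ⟨⟨Or.inl hwU, Or.inl hw'.2⟩, hww.symm, fun hh =>
      disjoint_left.1 hd hwO ((show w = w' from hh).symm ▸ hw'.1)⟩, rfl⟩
  have hA0 : A = ∅ := eq_empty_of_isClopen_of_isBounded ⟨hAcl, hAop⟩
    ((h.isCompact_union hl).isBounded.subset hAD)
  intro y hy y' hy' hpp
  by_contra hne
  have : y ∈ A := ⟨(y, y'), ⟨⟨hy, hy'⟩, hpp, hne⟩, rfl⟩
  rw [hA0] at this
  exact this

/-- The closure of the innermost region is mapped onto the punctured summand. -/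
theorem surjOn_union [T2Space M] (h : IsInnermost p c l U) (hs : IsSide e i c) (hl : IsCollar l)
    (hp : IsLocalHomeomorph p) (hps : Function.Surjective p) :
    SurjOn p (U ∪ l '' sphere 0 1) (range i) := by
  have hp' := hp.continuous
  have hM : PreconnectedSpace M := hps.denseRange.preconnectedSpace hp'
  have hT : IsClopen (p '' (U ∪ l '' sphere 0 1) ∪ (range i)ᶜ) := by
    constructor
    · have h1 : p '' (U ∪ l '' sphere 0 1) ∪ (range i)ᶜ =
          p '' (U ∪ l '' sphere 0 1) ∪ (range i \ c '' sphere 0 1)ᶜ := by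
        refine Subset.antisymm (union_subset_union_right _ (compl_subset_compl.2 sdiff_subset)) ?_
        rintro z (hz | hz)
        · exact Or.inl hz
        · by_cases hzi : z ∈ range i
          · have hzc : z ∈ c '' sphere 0 1 := by_contra fun h2 => hz ⟨hzi, h2⟩
            obtain ⟨x, hx, rfl⟩ := hzc
            exact Or.inl ⟨l x, Or.inr ⟨x, hx, rfl⟩, h.map_eq x (sphere_subset_compl_zero hx)⟩
          · exact Or.inr hzi
      rw [h1]
      exact ((h.isCompact_union hl).image hp').isClosed.union hs.isOpen_interior.isClosed_compl
    · have h1 : p '' (U ∪ l '' sphere 0 1) ∪ (range i)ᶜ = p '' U ∪ c '' {0}ᶜ ∪ (range i)ᶜ := by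
        ext z
        constructor
        · rintro (⟨y, hy | ⟨x, hx, rfl⟩, rfl⟩ | hz)
          · exact Or.inl (Or.inl ⟨y, hy, rfl⟩)
          · have hx0 := sphere_subset_compl_zero hx
            exact Or.inl (Or.inr ⟨x, hx0, (h.map_eq x hx0).symm⟩)
          · exact Or.inr hz
        · rintro ((⟨y, hy, rfl⟩ | ⟨x, hx, rfl⟩) | hz)
          · exact Or.inl ⟨y, Or.inl hy, rfl⟩
          · rcases le_or_gt 1 ‖x‖ with h2 | h2
            · exact Or.inl ⟨l x, h.mem_union h2, h.map_eq x hx⟩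
            · exact Or.inr (hs.collar_notMem x hx h2)
          · exact Or.inr hz
      rw [h1]
      exact ((hp.isOpenMap _ h.isOpen).union
        (hs.isCollar.isOpen_image isOpen_compl_singleton Subset.rfl)).union
        hs.isClosedEmbedding.isClosed_range.isOpen_compl
  obtain ⟨u, hu⟩ : ∃ u : V, u ∈ sphere (0 : V) 1 := by simpa using exists_norm_eq V zero_le_one
  have hne : (p '' (U ∪ l '' sphere 0 1) ∪ (range i)ᶜ).Nonempty :=
    ⟨_, Or.inl ⟨l u, Or.inr ⟨u, hu, rfl⟩, rfl⟩⟩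
  have huniv := hT.eq_univ hne
  intro z hz
  have h1 : z ∈ p '' (U ∪ l '' sphere 0 1) ∪ (range i)ᶜ := huniv ▸ mem_univ z
  exact h1.resolve_right fun h2 => h2 hz

end IsInnermost

end Side

/-! ### The summand as a quotient of the sphere -/

section Sphere

/-- Two compact Hausdorff images of a compact space under maps with the same fibres are
homeomorphic. -/
theorem nonempty_homeomorph_of_fibers {X Y Z : Type*} [TopologicalSpace X] [TopologicalSpace Y]
    [TopologicalSpace Z] [CompactSpace X] [T2Space Y] [T2Space Z] {f : X → Y} {g : X → Z}
    (hf : Continuous f) (hg : Continuous g) (hfs : Function.Surjective f)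
    (hgs : Function.Surjective g) (hfg : ∀ x x', f x = f x' ↔ g x = g x') : Nonempty (Y ≃ₜ Z) := by
  have : CompactSpace Y := ⟨by rw [← hfs.range_eq]; exact isCompact_range hf⟩
  choose s hs using hfs
  have h1 : ∀ x, g (s (f x)) = g x := fun x => (hfg _ _).1 (hs (f x))
  have h2 : Continuous fun y => g (s y) := by
    rw [(hf.isClosedMap.isQuotientMap hf fun y => ⟨s y, hs y⟩).continuous_iff]
    exact hg.congr fun x => (h1 x).symm
  refine ⟨h2.homeoOfEquivCompactToT2 (f := Equiv.ofBijective (fun y => g (s y))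
    ⟨fun y y' hyy => ?_, fun z => ?_⟩)⟩
  · have := (hfg _ _).2 hyy
    rwa [hs, hs] at this
  · obtain ⟨x, rfl⟩ := hgs z
    exact ⟨f x, h1 x⟩

/-- The collapse of a Hausdorff space onto the one-point compactification of an open subset. -/
theorem exists_collapse_to_onePoint {V X : Type*} [TopologicalSpace V] [TopologicalSpace X]
    [T2Space X] {e : V → X} (he : IsOpenEmbedding e) :
    ∃ q : X → OnePoint V, Continuous q ∧ (∀ x, q (e x) = x) ∧ ∀ m ∉ range e, q m = OnePoint.infty := by
  classical
  let q : X → OnePoint V := fun m => if h : m ∈ range e then (h.choose : V) else OnePoint.infty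
  have hq1 : ∀ x, q (e x) = x := fun x => by
    have h : e x ∈ range e := mem_range_self x
    have h' : h.choose = x := he.injective h.choose_spec
    simp only [q, dif_pos h, h']
  have hq2 : ∀ m ∉ range e, q m = OnePoint.infty := fun m hm => dif_neg hm
  refine ⟨q, continuous_iff_continuousAt.2 fun m => ?_, hq1, hq2⟩
  by_cases hm : m ∈ range e
  · obtain ⟨x, rfl⟩ := hm
    rw [← he.continuousAt_iff]
    exact (OnePoint.continuous_coe.congr fun x => (hq1 x).symm).continuousAt
  · rw [ContinuousAt, hq2 m hm]
    intro N hN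
    rw [OnePoint.hasBasis_nhds_infty.mem_iff] at hN
    obtain ⟨K, ⟨hK1, hK2⟩, hKN⟩ := hN
    have h1 : (e '' K)ᶜ ∈ 𝓝 m := (hK2.image he.continuous).isClosed.isOpen_compl.mem_nhds
      fun ⟨x, _, hx⟩ => hm ⟨x, hx⟩
    rw [mem_map]
    filter_upwards [h1] with z hz
    refine hKN ?_
    by_cases hz' : z ∈ range e
    · obtain ⟨x, rfl⟩ := hz'
      rw [hq1]
      exact Or.inl ⟨x, fun hx => hz ⟨x, hx, rfl⟩, rfl⟩
    · rw [hq2 z hz']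
      exact Or.inr rfl

variable {V : Type*} [NormedAddCommGroup V] [NormedSpace ℝ V] [Nontrivial V] [ProperSpace V]
  {M M₁ : Type*} [TopologicalSpace M] [T2Space M] [TopologicalSpace M₁]
  {e : V → M₁} {i : ((e '' ball 0 1)ᶜ : Set M₁) → M} {c : V → M} {p : V → M} {l : V → V}
  {U : Set V}

/-- Filling the outside of an innermost region by the ball of the summand: the sphere
`OnePoint V` maps onto the summand `M₁`, with one nondegenerate fibre. -/
theorem IsInnermost.exists_map_onePoint (h : IsInnermost p c l U) (hs : IsSide e i c)
    (hp : IsLocalHomeomorph p) (hps : Function.Surjective p) :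
    ∃ P : OnePoint V → M₁, Continuous P ∧ Function.Surjective P ∧
      ∀ z z', P z = P z' → z = z' ∨ P z = e 0 := by
  have hl : IsCollar l := hs.isCollar.lift hp h.continuousOn h.map_eq
  have he := hs.isOpenEmbedding
  have hi := hs.isClosedEmbedding
  -- points of the collar in the closure of `U`
  have hcol : ∀ x (a : ((e '' ball 0 1)ᶜ : Set M₁)), x ≠ 0 → l x ∈ U ∪ l '' sphere 0 1 →
      i a = p (l x) → (a : M₁) = e x := fun x a hx hxU ha => by
    have h1 := h.one_le_norm hx hxU hl.injOn
    have h2 := hs.collar_eq x ⟨e x, hs.mem_compl_image_ball.2 h1⟩ h1 rfl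
    rw [h.map_eq x hx, h2] at ha
    exact congr_arg Subtype.val (hi.injective ha)
  have hex : ∀ z : OnePoint V, ∃ m : M₁,
      (∀ y ∈ U, z = (y : OnePoint V) → ∃ a : ((e '' ball 0 1)ᶜ : Set M₁), m = a ∧ i a = p y) ∧
      (∀ x, x ≠ 0 → z = (l x : OnePoint V) → m = e x) ∧
      ((∀ y ∈ U, z ≠ (y : OnePoint V)) → (∀ x, x ≠ 0 → z ≠ (l x : OnePoint V)) → m = e 0) := by
    intro z
    by_cases h1 : ∃ y ∈ U, z = (y : OnePoint V)
    · obtain ⟨y, hy, rfl⟩ := h1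
      obtain ⟨a, ha⟩ := h.map_mem_range hs hl hp.continuous (Or.inl hy)
      refine ⟨a, fun y' _ hyy => ⟨a, rfl, ?_⟩, fun x hx hyx => ?_, fun h1 => absurd rfl (h1 y hy)⟩
      · rw [ha, OnePoint.coe_injective hyy]
      · have h2 := OnePoint.coe_injective hyx
        subst h2
        exact hcol x a hx (Or.inl hy) ha
    · push Not at h1
      by_cases h2 : ∃ x, x ≠ 0 ∧ z = (l x : OnePoint V)
      · obtain ⟨x, hx, rfl⟩ := h2
        refine ⟨e x, fun y hy hyx => absurd hyx (h1 y hy), fun x' hx' hxx => ?_,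
          fun _ h3 => absurd rfl (h3 x hx)⟩
        rw [hl.injOn hx hx' (OnePoint.coe_injective hxx)]
      · push Not at h2
        exact ⟨e 0, fun y hy hyx => absurd hyx (h1 y hy), fun x hx hzx => absurd hzx (h2 x hx),
          fun _ _ => rfl⟩
  choose P hP1 hP2 hP3 using hex
  have hPU : ∀ y ∈ U, ∃ a : ((e '' ball 0 1)ᶜ : Set M₁), P y = a ∧ i a = p y :=
    fun y hy => hP1 y y hy rfl
  have hPl : ∀ x, x ≠ 0 → P (l x) = e x := fun x hx => hP2 _ x hx rfl
  have hcases : ∀ z : OnePoint V, (∃ y ∈ U, z = y) ∨ (∃ x, x ≠ 0 ∧ z = l x) ∨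
      ((∀ y ∈ U, z ≠ (y : OnePoint V)) ∧ (∀ x, x ≠ 0 → z ≠ (l x : OnePoint V))) := fun z => by
    by_cases h1 : ∃ y ∈ U, z = (y : OnePoint V)
    · exact Or.inl h1
    by_cases h2 : ∃ x, x ≠ 0 ∧ z = (l x : OnePoint V)
    · exact Or.inr (Or.inl h2)
    · push Not at h1 h2
      exact Or.inr (Or.inr ⟨h1, h2⟩)
  refine ⟨P, continuous_iff_continuousAt.2 fun z => ?_, fun m => ?_, fun z z' hzz => ?_⟩
  · rcases hcases z with ⟨y, hy, rfl⟩ | ⟨x, hx, rfl⟩ | ⟨h1, h2⟩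
    · rw [← OnePoint.isOpenEmbedding_coe.continuousAt_iff]
      choose a ha1 ha2 using fun y : U => hPU y y.2
      have h3 : Continuous a := by
        rw [hi.isInducing.continuous_iff]
        exact (hp.continuous.comp continuous_subtype_val).congr fun y => (ha2 y).symm
      have h4 : ContinuousOn (P ∘ (↑)) U :=
        continuousOn_iff_continuous_domRestrict.2
          ((continuous_subtype_val.comp h3).congr fun y => (ha1 y).symm)
      exact h4.continuousAt (h.isOpen.mem_nhds hy)
    · have h1 : IsOpenEmbedding fun x : ({0}ᶜ : Set V) => (l x : OnePoint V) :=
        OnePoint.isOpenEmbedding_coe.comp hl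
      have h2 := h1.continuousAt_iff (g := P) (x := ⟨x, hx⟩)
      refine h2.1 (Continuous.continuousAt ?_)
      exact (he.continuous.comp continuous_subtype_val).congr fun x => (hPl x x.2).symm
    · rw [ContinuousAt, hP3 z h1 h2]
      intro W hW
      have hW' : e ⁻¹' W ∈ 𝓝 0 := he.continuous.continuousAt hW
      obtain ⟨r, hr0, hr⟩ := Metric.mem_nhds_iff.1 hW'
      let K : Set V := U ∪ l '' sphere 0 1 ∪ l '' (closedBall 0 1 \ ball 0 r)
      have hK0 : closedBall (0 : V) 1 \ ball 0 r ⊆ {0}ᶜ := fun x hx hx' => hx.2 (by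
        rw [mem_singleton_iff.1 hx']; exact mem_ball_self hr0)
      have hK : IsCompact K := (h.isCompact_union hl).union
        (((isCompact_closedBall 0 1).diff isOpen_ball).image_of_continuousOn
          (hl.continuousOn.mono hK0))
      have h3 : ((↑) '' K : Set (OnePoint V))ᶜ ∈ 𝓝 z := by
        refine (OnePoint.isOpen_compl_image_coe.2 ⟨hK.isClosed, hK⟩).mem_nhds ?_
        rintro ⟨y, (hy | ⟨x, hx, rfl⟩) | ⟨x, hx, rfl⟩, hyz⟩
        · exact h1 y hy hyz.symm
        · exact h2 x (sphere_subset_compl_zero hx) hyz.symm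
        · exact h2 x (hK0 hx) hyz.symm
      rw [mem_map]
      filter_upwards [h3] with z' hz'
      rcases hcases z' with ⟨y, hy, rfl⟩ | ⟨x, hx, rfl⟩ | ⟨h4, h5⟩
      · exact absurd ⟨y, Or.inl (Or.inl hy), rfl⟩ hz'
      · rw [mem_preimage, hPl x hx]
        refine hr (by_contra fun hxr => hz' ⟨l x, ?_, rfl⟩)
        rcases le_or_gt 1 ‖x‖ with h4 | h4
        · exact Or.inl (h.mem_union h4)
        · exact Or.inr ⟨x, ⟨by simpa using h4.le, hxr⟩, rfl⟩
      · rw [mem_preimage, hP3 z' h4 h5]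
        exact mem_of_mem_nhds hW
  · by_cases hm : m ∈ (e '' ball 0 1)ᶜ
    · obtain ⟨y, hy, hyi⟩ := h.surjOn_union hs hl hp hps (mem_range_self ⟨m, hm⟩)
      rcases hy with hy | ⟨x, hx, rfl⟩
      · obtain ⟨a, ha, hay⟩ := hPU y hy
        exact ⟨y, by rw [ha, hi.injective (hay.trans hyi)]⟩
      · have hx0 := sphere_subset_compl_zero hx
        exact ⟨l x, by rw [hPl x hx0, ← hcol x ⟨m, hm⟩ hx0 (Or.inr ⟨x, hx, rfl⟩) hyi.symm]⟩
    · rw [notMem_compl_iff] at hm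
      obtain ⟨x, -, rfl⟩ := hm
      rcases eq_or_ne x 0 with rfl | hx
      · exact ⟨OnePoint.infty, hP3 _ (fun y _ => OnePoint.infty_ne_coe y)
          fun x _ => OnePoint.infty_ne_coe _⟩
      · exact ⟨l x, hPl x hx⟩
  · have hinj := h.injOn_union hs.isCollar hl hp
    -- a point of `U` and a point of the collar
    have hUl : ∀ y ∈ U, ∀ x, x ≠ 0 → P y = P (l x) → y = l x := fun y hy x hx hyx => by
      obtain ⟨a, ha, hay⟩ := hPU y hy
      rw [ha, hPl x hx] at hyx
      have h1 : 1 ≤ ‖x‖ := hs.mem_compl_image_ball.1 (hyx ▸ a.2)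
      refine hinj (Or.inl hy) (h.mem_union h1) ?_
      rw [h.map_eq x hx, hs.collar_eq x a h1 hyx, hay]
    rcases hcases z with ⟨y, hy, rfl⟩ | ⟨x, hx, rfl⟩ | ⟨h1, h2⟩
    · rcases hcases z' with ⟨y', hy', rfl⟩ | ⟨x', hx', rfl⟩ | ⟨h1', h2'⟩
      · obtain ⟨a, ha, hay⟩ := hPU y hy
        obtain ⟨a', ha', hay'⟩ := hPU y' hy'
        rw [ha, ha'] at hzz
        left
        rw [hinj (Or.inl hy) (Or.inl hy') (by rw [← hay, ← hay', Subtype.val_injective hzz])]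
      · exact Or.inl (by rw [hUl y hy x' hx' hzz])
      · exact Or.inr (by rw [hzz, hP3 z' h1' h2'])
    · rcases hcases z' with ⟨y', hy', rfl⟩ | ⟨x', hx', rfl⟩ | ⟨h1', h2'⟩
      · exact Or.inl (by rw [hUl y' hy' x hx hzz.symm])
      · rw [hPl x hx, hPl x' hx'] at hzz
        exact Or.inl (by rw [he.injective hzz])
      · exact Or.inr (by rw [hzz, hP3 z' h1' h2'])
    · exact Or.inr (hP3 z h1 h2)

/-- A summand into which an innermost lift of its collar runs is a sphere. -/
theorem IsInnermost.nonempty_homeomorph_onePoint [T2Space M₁] (h : IsInnermost p c l U) (hs : IsSide e i c)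
    (hp : IsLocalHomeomorph p) (hps : Function.Surjective p)
    (hS : ∀ x : OnePoint V, ∃ j : V → OnePoint V, IsOpenEmbedding j ∧ range j = {x}ᶜ) :
    Nonempty (M₁ ≃ₜ OnePoint V) := by
  obtain ⟨P, hP, hPs, hPi⟩ := h.exists_map_onePoint hs hp hps
  have he := hs.isOpenEmbedding
  have hM₁ : CompactSpace M₁ := ⟨by rw [← hPs.range_eq]; exact isCompact_range hP⟩
  obtain ⟨q, hq, hqe, hqr⟩ := exists_collapse_to_onePoint he
  have hnc : NoncompactSpace V := inferInstance
  obtain ⟨m, hm⟩ : ∃ m, m ∉ range e := by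
    by_contra! hall
    have h1 : IsCompact (e ⁻¹' univ) :=
      (he.isInducing.isCompact_preimage_iff fun m _ => hall m).2 isCompact_univ
    exact noncompact_univ V h1
  have hqs : Function.Surjective q := fun z => by
    induction z using OnePoint.rec with
    | infty => exact ⟨m, hqr m hm⟩
    | coe x => exact ⟨e x, hqe x⟩
  have hq' : ∀ m m', q m = q m' → q m ≠ OnePoint.infty → m = m' := fun m m' hmm hm => by
    have h1 : m ∈ range e := by_contra fun h1 => hm (hqr m h1)
    have h2 : m' ∈ range e := by_contra fun h2 => hm (by rw [hmm, hqr m' h2])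
    obtain ⟨x, rfl⟩ := h1
    obtain ⟨x', rfl⟩ := h2
    rw [hqe, hqe] at hmm
    rw [OnePoint.coe_injective hmm]
  have hq0 : ∀ m, q m = ((0 : V) : OnePoint V) ↔ m = e 0 := fun m =>
    ⟨fun hm => hq' m (e 0) (by rw [hm, hqe]) (by rw [hm]; exact OnePoint.coe_ne_infty _),
      fun hm => by rw [hm, hqe]⟩
  obtain ⟨T, hT, hTs, hTi⟩ := exists_collapse_of_two_fibers hS (f := q ∘ P) (hq.comp hP)
    (hqs.comp hPs) (OnePoint.infty_ne_coe (0 : V)) fun z z' hzz h1 h2 =>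
      (hPi z z' (hq' _ _ hzz h1)).resolve_right fun h3 => h2 ((hq0 _).2 h3)
  refine nonempty_homeomorph_of_fibers hP hT hPs hTs fun z z' => ?_
  rw [hTi, Function.comp_apply, Function.comp_apply, hq0, hq0]
  constructor
  · intro hzz
    rcases hPi z z' hzz with h1 | h1
    · exact Or.inl h1
    · exact Or.inr ⟨h1, hzz ▸ h1⟩
  · rintro (rfl | ⟨h1, h2⟩)
    · rfl
    · rw [h1, h2]

/-- Spheres are homogeneous: the complement of any point is an open cell. -/
theorem exists_isOpenEmbedding_onePoint_range_eq_compl (n : ℕ)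
    (x : OnePoint (EuclideanSpace ℝ (Fin n))) :
    ∃ j : EuclideanSpace ℝ (Fin n) → OnePoint (EuclideanSpace ℝ (Fin n)),
      IsOpenEmbedding j ∧ range j = {x}ᶜ := by
  have hn : Module.finrank ℝ (EuclideanSpace ℝ (Fin n)) + 1 = Fintype.card (Fin (n + 1)) := by simp
  let Φ := onePointEquivSphereOfFinrankEq hn
  obtain ⟨v, hv⟩ : ∃ v, v = Φ x := ⟨_, rfl⟩
  have hv1 : ‖(v : EuclideanSpace ℝ (Fin (n + 1)))‖ = 1 := by simp
  have hv0 : (v : EuclideanSpace ℝ (Fin (n + 1))) ≠ 0 := norm_ne_zero_iff.1 (by rw [hv1]; simp)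
  have : Fact (Module.finrank ℝ (EuclideanSpace ℝ (Fin (n + 1))) = n + 1) := ⟨by simp⟩
  have hV : Module.finrank ℝ (EuclideanSpace ℝ (Fin n)) =
      Module.finrank ℝ (ℝ ∙ (v : EuclideanSpace ℝ (Fin (n + 1))))ᗮ := by
    rw [Submodule.finrank_orthogonal_span_singleton (n := n) hv0]; simp
  let L := (FiniteDimensional.nonempty_continuousLinearEquiv_of_finrank_eq hV).some
  refine ⟨Φ.symm ∘ (stereographic hv1).symm ∘ L, Φ.symm.isOpenEmbedding.comp
    ((isOpenEmbedding_stereographic_symm hv1).comp L.toHomeomorph.isOpenEmbedding), ?_⟩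
  rw [range_comp, range_comp, L.surjective.range_eq, image_univ, range_stereographic_symm hv1 v.2,
    image_compl_eq Φ.symm.bijective, image_singleton]
  simp [hv]

end Sphere

/-! ### Connected sums as gluings -/

section Inversion

variable {V : Type*} [NormedAddCommGroup V] [NormedSpace ℝ V]

/-- The inversion in the unit sphere, which keeps directions and inverts the norm. -/
noncomputable def sphereInv (x : V) : V := radialMap (fun t => t⁻¹) x

theorem norm_sphereInv (x : V) : ‖sphereInv x‖ = ‖x‖⁻¹ :=
  norm_radialMap inv_zero (fun _ => inv_pos.2) x

theorem sphereInv_sphereInv (x : V) : sphereInv (sphereInv x) = x :=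
  radialMap_radialMap inv_zero (fun _ => inv_pos.2) (inv_inv _)

theorem sphereInv_ne_zero {x : V} (hx : x ≠ 0) : sphereInv x ≠ 0 := by
  rw [← norm_ne_zero_iff, norm_sphereInv]
  exact inv_ne_zero (norm_ne_zero_iff.2 hx)

theorem sphereInv_of_norm_eq_one {x : V} (hx : ‖x‖ = 1) : sphereInv x = x :=
  radialMap_eq_self (by rw [hx, inv_one])

theorem continuousOn_sphereInv : ContinuousOn (sphereInv : V → V) {0}ᶜ := fun _ hx =>
  (continuousAt_radialMap inv_zero (fun _ => inv_pos.2)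
    (continuousAt_inv₀ (norm_ne_zero_iff.2 hx))).continuousWithinAt

theorem image_sphereInv_eq_preimage (O : Set V) : sphereInv '' O = sphereInv ⁻¹' O :=
  congr_fun (image_eq_preimage_of_inverse sphereInv_sphereInv sphereInv_sphereInv) O

theorem one_le_norm_sphereInv {x : V} (hx : x ≠ 0) (h : ‖x‖ ≤ 1) : 1 ≤ ‖sphereInv x‖ := by
  rw [norm_sphereInv]
  exact (one_le_inv₀ (norm_pos_iff.2 hx)).2 h

theorem norm_sphereInv_le_one {x : V} (h : 1 ≤ ‖x‖) : ‖sphereInv x‖ ≤ 1 := by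
  rw [norm_sphereInv]
  exact inv_le_one_of_one_le₀ h

variable {M M₁ M₂ : Type*}

/-- `c` is the collar of the boundary sphere in the gluing that runs along `e₁` outside the unit
sphere and along `e₂`, inverted in the unit sphere, inside. -/
structure IsGluingCollar (e₁ : V → M₁) (e₂ : V → M₂) (i₁ : ((e₁ '' ball 0 1)ᶜ : Set M₁) → M)
    (i₂ : ((e₂ '' ball 0 1)ᶜ : Set M₂) → M) (c : V → M) : Prop where
  eq₁ : ∀ (x : V) (a : ((e₁ '' ball 0 1)ᶜ : Set M₁)), 1 ≤ ‖x‖ → (a : M₁) = e₁ x → c x = i₁ a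
  eq₂ : ∀ (x : V) (b : ((e₂ '' ball 0 1)ᶜ : Set M₂)), x ≠ 0 → ‖x‖ ≤ 1 →
    (b : M₂) = e₂ (sphereInv x) → c x = i₂ b

theorem IsGluingCollar.symm {e₁ : V → M₁} {e₂ : V → M₂}
    {i₁ : ((e₁ '' ball 0 1)ᶜ : Set M₁) → M} {i₂ : ((e₂ '' ball 0 1)ᶜ : Set M₂) → M} {c : V → M}
    (hc : IsGluingCollar e₁ e₂ i₁ i₂ c) :
    IsGluingCollar e₂ e₁ i₂ i₁ (c ∘ sphereInv) where
  eq₁ x b hx hb := hc.eq₂ _ b (sphereInv_ne_zero (ne_zero_of_one_le_norm hx))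
    (norm_sphereInv_le_one hx) (by rw [sphereInv_sphereInv, hb])
  eq₂ x a hx0 hx ha := hc.eq₁ _ a (one_le_norm_sphereInv hx0 hx) ha

end Inversion

section Gluing

variable {V : Type*} [NormedAddCommGroup V] {M M₁ M₂ : Type*} [TopologicalSpace M]
  [TopologicalSpace M₁] [TopologicalSpace M₂]

/-- `M` is the gluing of the punctured summands `M₁ \ e₁ (ball 0 1)` and `M₂ \ e₂ (ball 0 1)`, mapped
to `M` by `i₁` and `i₂`, along their boundary spheres. -/
structure IsGluing (e₁ : V → M₁) (e₂ : V → M₂) (i₁ : ((e₁ '' ball 0 1)ᶜ : Set M₁) → M)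
    (i₂ : ((e₂ '' ball 0 1)ᶜ : Set M₂) → M) : Prop where
  isOpenEmbedding₁ : IsOpenEmbedding e₁
  isOpenEmbedding₂ : IsOpenEmbedding e₂
  continuous₁ : Continuous i₁
  continuous₂ : Continuous i₂
  injective₁ : Function.Injective i₁
  injective₂ : Function.Injective i₂
  eq_iff : ∀ a b, i₁ a = i₂ b ↔ ∃ x ∈ sphere (0 : V) 1, (a : M₁) = e₁ x ∧ (b : M₂) = e₂ x
  range_union : range i₁ ∪ range i₂ = univ
  isOpen_of_preimage : ∀ W : Set M, IsOpen (i₁ ⁻¹' W) → IsOpen (i₂ ⁻¹' W) → IsOpen W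

namespace IsGluing

variable {e₁ : V → M₁} {e₂ : V → M₂} {i₁ : ((e₁ '' ball 0 1)ᶜ : Set M₁) → M}
  {i₂ : ((e₂ '' ball 0 1)ᶜ : Set M₂) → M}

theorem symm (h : IsGluing e₁ e₂ i₁ i₂) : IsGluing e₂ e₁ i₂ i₁ where
  isOpenEmbedding₁ := h.isOpenEmbedding₂
  isOpenEmbedding₂ := h.isOpenEmbedding₁
  continuous₁ := h.continuous₂
  continuous₂ := h.continuous₁
  injective₁ := h.injective₂
  injective₂ := h.injective₁
  eq_iff b a := by
    rw [eq_comm, h.eq_iff]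
    exact exists_congr fun x => and_congr_right fun _ => and_comm
  range_union := by rw [union_comm, h.range_union]
  isOpen_of_preimage W h1 h2 := h.isOpen_of_preimage W h2 h1

theorem mem_compl_image_ball (h : IsGluing e₁ e₂ i₁ i₂) {x : V} :
    e₁ x ∈ (e₁ '' ball 0 1)ᶜ ↔ 1 ≤ ‖x‖ := by
  rw [mem_compl_iff, h.isOpenEmbedding₁.injective.mem_set_image, mem_ball_zero_iff, not_lt]

theorem isClosedEmbedding [ProperSpace V] [T2Space M₂] (h : IsGluing e₁ e₂ i₁ i₂) :
    IsClosedEmbedding i₁ := by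
  refine IsClosedEmbedding.of_continuous_injective_isClosedMap h.continuous₁ h.injective₁
    fun C hC => ?_
  have h1 : IsClosed (Subtype.val '' C) :=
    (h.isOpenEmbedding₁.isOpenMap _ isOpen_ball).isClosed_compl.isClosedMap_subtype_val _ hC
  have h2 : i₂ ⁻¹' (i₁ '' C) =
      Subtype.val ⁻¹' (e₂ '' (sphere 0 1 ∩ e₁ ⁻¹' (Subtype.val '' C))) := by
    ext b
    constructor
    · rintro ⟨a, ha, hab⟩
      obtain ⟨x, hx, hax, hbx⟩ := (h.eq_iff a b).1 hab
      exact ⟨x, ⟨hx, a, ha, hax⟩, hbx.symm⟩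
    · rintro ⟨x, ⟨hx, a, ha, hax⟩, hbx⟩
      exact ⟨a, ha, (h.eq_iff a b).2 ⟨x, hx, hax, hbx.symm⟩⟩
  have h3 : IsClosed (e₂ '' (sphere 0 1 ∩ e₁ ⁻¹' (Subtype.val '' C))) :=
    (((isCompact_sphere 0 1).inter_right (h1.preimage h.isOpenEmbedding₁.continuous)).image
      h.isOpenEmbedding₂.continuous).isClosed
  rw [← isOpen_compl_iff]
  refine h.isOpen_of_preimage _ ?_ ?_
  · rw [preimage_compl, preimage_image_eq _ h.injective₁]
    exact hC.isOpen_compl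
  · rw [preimage_compl, h2]
    exact (h3.preimage continuous_subtype_val).isOpen_compl

end IsGluing

variable [NormedSpace ℝ V] {e₁ : V → M₁} {e₂ : V → M₂} {i₁ : ((e₁ '' ball 0 1)ᶜ : Set M₁) → M}
  {i₂ : ((e₂ '' ball 0 1)ᶜ : Set M₂) → M} {c : V → M}

theorem IsGluing.exists_collar [Nontrivial V] (h : IsGluing e₁ e₂ i₁ i₂) :
    ∃ c, IsGluingCollar e₁ e₂ i₁ i₂ c := by
  obtain ⟨u, hu⟩ : ∃ u : V, ‖u‖ = 1 := exists_norm_eq V zero_le_one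
  have hex : ∀ x : V, ∃ m : M,
      (∀ a : ((e₁ '' ball 0 1)ᶜ : Set M₁), 1 ≤ ‖x‖ → (a : M₁) = e₁ x → m = i₁ a) ∧
      (∀ b : ((e₂ '' ball 0 1)ᶜ : Set M₂), x ≠ 0 → ‖x‖ ≤ 1 →
        (b : M₂) = e₂ (sphereInv x) → m = i₂ b) := fun x => by
    rcases eq_or_ne x 0 with rfl | hx
    · refine ⟨i₁ ⟨e₁ u, h.mem_compl_image_ball.2 hu.ge⟩, fun a ha => ?_, fun b hb => ?_⟩
      · rw [norm_zero] at ha; linarith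
      · exact absurd rfl hb
    rcases le_or_gt 1 ‖x‖ with hx1 | hx1
    · refine ⟨i₁ ⟨e₁ x, h.mem_compl_image_ball.2 hx1⟩, fun a _ ha => ?_, fun b _ hx2 hb => ?_⟩
      · congr 1; exact Subtype.ext ha.symm
      · have hx3 : ‖x‖ = 1 := le_antisymm hx2 hx1
        rw [sphereInv_of_norm_eq_one hx3] at hb
        exact (h.eq_iff _ _).2 ⟨x, by simpa using hx3, rfl, hb⟩
    · refine ⟨i₂ ⟨e₂ (sphereInv x), h.symm.mem_compl_image_ball.2
        (one_le_norm_sphereInv hx hx1.le)⟩, fun a ha => ?_, fun b _ _ hb => ?_⟩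
      · linarith
      · congr 1; exact Subtype.ext hb.symm
  choose c hc1 hc2 using hex
  exact ⟨c, hc1, hc2⟩

namespace IsGluingCollar

theorem exists_eq₁ (hc : IsGluingCollar e₁ e₂ i₁ i₂ c) (h : IsGluing e₁ e₂ i₁ i₂) {x : V}
    (hx : 1 ≤ ‖x‖) : ∃ a : ((e₁ '' ball 0 1)ᶜ : Set M₁), (a : M₁) = e₁ x ∧ c x = i₁ a :=
  ⟨⟨e₁ x, h.mem_compl_image_ball.2 hx⟩, rfl, hc.eq₁ _ _ hx rfl⟩

theorem exists_eq₂ (hc : IsGluingCollar e₁ e₂ i₁ i₂ c) (h : IsGluing e₁ e₂ i₁ i₂) {x : V}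
    (hx0 : x ≠ 0) (hx : ‖x‖ ≤ 1) :
    ∃ b : ((e₂ '' ball 0 1)ᶜ : Set M₂), (b : M₂) = e₂ (sphereInv x) ∧ c x = i₂ b :=
  ⟨⟨e₂ (sphereInv x), h.symm.mem_compl_image_ball.2 (one_le_norm_sphereInv hx0 hx)⟩, rfl,
    hc.eq₂ _ _ hx0 hx rfl⟩

/-- A collar point that lies in the first summand comes from outside the open unit ball. -/
theorem eq_of_eq₁ (hc : IsGluingCollar e₁ e₂ i₁ i₂ c) (h : IsGluing e₁ e₂ i₁ i₂) {x : V}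
    (hx0 : x ≠ 0) {a : ((e₁ '' ball 0 1)ᶜ : Set M₁)} (hxa : c x = i₁ a) :
    1 ≤ ‖x‖ ∧ (a : M₁) = e₁ x := by
  rcases le_or_gt 1 ‖x‖ with hx | hx
  · obtain ⟨a', ha', hxa'⟩ := hc.exists_eq₁ h hx
    rw [hxa] at hxa'
    exact ⟨hx, by rw [h.injective₁ hxa', ha']⟩
  · obtain ⟨b, hb, hxb⟩ := hc.exists_eq₂ h hx0 hx.le
    rw [hxa] at hxb
    obtain ⟨z, hz, haz, hbz⟩ := (h.eq_iff _ _).1 hxb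
    have hz1 := mem_sphere_zero_iff_norm.1 hz
    have h1 : sphereInv x = z := h.isOpenEmbedding₂.injective (hb.symm.trans hbz)
    have h2 : x = z := by rw [← sphereInv_sphereInv x, h1, sphereInv_of_norm_eq_one hz1]
    rw [h2, hz1] at hx
    exact absurd hx (lt_irrefl _)

theorem continuousOn_outside (hc : IsGluingCollar e₁ e₂ i₁ i₂ c) (h : IsGluing e₁ e₂ i₁ i₂) :
    ContinuousOn c {x | 1 ≤ ‖x‖} := by
  rw [continuousOn_iff_continuous_domRestrict]
  have h1 : Continuous fun x : {x : V | 1 ≤ ‖x‖} =>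
      i₁ ⟨e₁ x, h.mem_compl_image_ball.2 x.2⟩ :=
    h.continuous₁.comp ((h.isOpenEmbedding₁.continuous.comp continuous_subtype_val).subtype_mk _)
  exact h1.congr fun x => (hc.eq₁ x _ x.2 rfl).symm

theorem continuousOn (hc : IsGluingCollar e₁ e₂ i₁ i₂ c) (h : IsGluing e₁ e₂ i₁ i₂) :
    ContinuousOn c {0}ᶜ := by
  have h1 := hc.continuousOn_outside h
  have h2 : ContinuousOn c {x | x ≠ 0 ∧ ‖x‖ ≤ 1} := by
    have h3 := (hc.symm.continuousOn_outside h.symm).comp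
      (continuousOn_sphereInv.mono fun x (hx : x ≠ 0 ∧ ‖x‖ ≤ 1) => hx.1)
      fun x hx => one_le_norm_sphereInv hx.1 hx.2
    exact h3.congr fun x _ => by simp [sphereInv_sphereInv]
  have h3 : ({0}ᶜ : Set V) = {x | 1 ≤ ‖x‖} ∪ {x | x ≠ 0 ∧ ‖x‖ ≤ 1} := by
    ext x
    constructor
    · intro hx
      rcases le_total 1 ‖x‖ with h | h
      · exact Or.inl h
      · exact Or.inr ⟨hx, h⟩
    · rintro (hx | hx)
      · exact ne_zero_of_one_le_norm hx
      · exact hx.1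
  intro x hx
  rw [h3]
  refine ContinuousWithinAt.union ?_ ?_
  · by_cases hx1 : 1 ≤ ‖x‖
    · exact h1 x hx1
    · refine continuousWithinAt_of_notMem_closure fun h4 => hx1 ?_
      rwa [(isClosed_le continuous_const continuous_norm).closure_eq] at h4
  · by_cases hx1 : ‖x‖ ≤ 1
    · exact h2 x ⟨hx, hx1⟩
    · refine continuousWithinAt_of_notMem_closure fun h4 => hx1 ?_
      exact closure_minimal (fun y hy => hy.2) (isClosed_le continuous_norm continuous_const) h4

theorem injOn (hc : IsGluingCollar e₁ e₂ i₁ i₂ c) (h : IsGluing e₁ e₂ i₁ i₂) :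
    InjOn c {0}ᶜ := by
  intro x hx y hy hxy
  rcases le_total 1 ‖x‖ with hx1 | hx1
  · obtain ⟨a, ha, hxa⟩ := hc.exists_eq₁ h hx1
    have h1 := hc.eq_of_eq₁ h hy (hxy.symm.trans hxa)
    exact h.isOpenEmbedding₁.injective (ha.symm.trans h1.2)
  · obtain ⟨b, hb, hxb⟩ := hc.exists_eq₂ h hx hx1
    have h1 := hc.symm.eq_of_eq₁ h.symm (x := sphereInv y) (sphereInv_ne_zero hy) (a := b)
      (by rw [Function.comp_apply, sphereInv_sphereInv, ← hxy, hxb])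
    have h2 := h.isOpenEmbedding₂.injective (hb.symm.trans h1.2)
    rw [← sphereInv_sphereInv x, h2, sphereInv_sphereInv]

theorem isOpen_preimage_image (hc : IsGluingCollar e₁ e₂ i₁ i₂ c) (h : IsGluing e₁ e₂ i₁ i₂)
    {O : Set V} (hO : IsOpen O) (h0 : O ⊆ {0}ᶜ) : IsOpen (i₁ ⁻¹' (c '' O)) := by
  have h1 : i₁ ⁻¹' (c '' O) = Subtype.val ⁻¹' (e₁ '' O) := by
    ext a
    constructor
    · rintro ⟨x, hx, hxa⟩
      exact ⟨x, hx, (hc.eq_of_eq₁ h (h0 hx) hxa).2.symm⟩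
    · rintro ⟨x, hx, hxa⟩
      have h2 : 1 ≤ ‖x‖ := h.mem_compl_image_ball.1 (hxa ▸ a.2)
      exact ⟨x, hx, hc.eq₁ x a h2 hxa.symm⟩
  rw [h1]
  exact (h.isOpenEmbedding₁.isOpenMap _ hO).preimage continuous_subtype_val

theorem isCollar (hc : IsGluingCollar e₁ e₂ i₁ i₂ c) (h : IsGluing e₁ e₂ i₁ i₂) : IsCollar c := by
  refine IsOpenEmbedding.of_continuous_injective_isOpenMap
    (continuousOn_iff_continuous_domRestrict.1 (hc.continuousOn h))
    (injOn_iff_injective.1 (hc.injOn h)) fun O hO => ?_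
  have hO1 : IsOpen (Subtype.val '' O) := isOpen_compl_singleton.isOpenMap_subtype_val _ hO
  have hO0 : Subtype.val '' O ⊆ ({0}ᶜ : Set V) := by
    rintro _ ⟨x, -, rfl⟩; exact x.2
  have hO2 : ({0}ᶜ : Set V).domRestrict c '' O = c '' (Subtype.val '' O) := by
    rw [domRestrict_eq, image_comp]
  rw [hO2]
  refine h.isOpen_of_preimage _ (hc.isOpen_preimage_image h hO1 hO0) ?_
  have h3 : c '' (Subtype.val '' O) = (c ∘ sphereInv) '' (sphereInv '' (Subtype.val '' O)) := by
    generalize Subtype.val '' O = A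
    rw [← image_comp]
    exact image_congr fun x _ => by simp [sphereInv_sphereInv]
  have h4 : sphereInv '' (Subtype.val '' O) ⊆ ({0}ᶜ : Set V) := by
    rintro _ ⟨x, hx, rfl⟩; exact sphereInv_ne_zero (hO0 hx)
  rw [h3]
  refine hc.symm.isOpen_preimage_image h.symm ?_ h4
  have h5 := continuousOn_sphereInv.isOpen_inter_preimage isOpen_compl_singleton hO1
  rwa [← image_sphereInv_eq_preimage, inter_eq_right.2 h4] at h5

theorem isSide [ProperSpace V] [T2Space M₁] [T2Space M₂] (hc : IsGluingCollar e₁ e₂ i₁ i₂ c)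
    (h : IsGluing e₁ e₂ i₁ i₂) : IsSide e₁ i₁ c where
  isOpenEmbedding := h.isOpenEmbedding₁
  isClosedEmbedding := h.isClosedEmbedding
  isCollar := hc.isCollar h
  isOpen_interior := by
    have h1 : range i₁ \ c '' sphere 0 1 = (range i₂)ᶜ := by
      ext m
      constructor
      · rintro ⟨⟨a, rfl⟩, hm⟩ ⟨b, hb⟩
        obtain ⟨x, hx, hax, -⟩ := (h.eq_iff a b).1 hb.symm
        exact hm ⟨x, hx, hc.eq₁ x a (mem_sphere_zero_iff_norm.1 hx).ge hax⟩
      · intro hm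
        have h2 : m ∈ range i₁ ∪ range i₂ := h.range_union ▸ mem_univ m
        refine ⟨h2.resolve_right hm, ?_⟩
        rintro ⟨x, hx, rfl⟩
        obtain ⟨b, -, hb⟩ := hc.exists_eq₂ h (sphere_subset_compl_zero hx)
          (mem_sphere_zero_iff_norm.1 hx).le
        exact hm ⟨b, hb.symm⟩
    rw [h1]
    exact h.symm.isClosedEmbedding.isClosed_range.isOpen_compl
  collar_eq := hc.eq₁
  collar_notMem x hx0 hx := by
    rintro ⟨a, ha⟩
    exact absurd (hc.eq_of_eq₁ h hx0 ha.symm).1 (not_le.2 hx)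

end IsGluingCollar

end Gluing

section ConnectedSum

/-- The two punctured summands sit in a connected sum as in a gluing: the relation that generates
the quotient identifies no other points. -/
theorem IsConnectedSum.exists_isGluing {n : ℕ} {M M₁ M₂ : Type*} [TopologicalSpace M]
    [TopologicalSpace M₁] [TopologicalSpace M₂] (h : IsConnectedSum n M M₁ M₂) :
    ∃ (e₁ : EuclideanSpace ℝ (Fin n) → M₁) (e₂ : EuclideanSpace ℝ (Fin n) → M₂)
      (i₁ : ((e₁ '' ball 0 1)ᶜ : Set M₁) → M) (i₂ : ((e₂ '' ball 0 1)ᶜ : Set M₂) → M),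
      IsGluing e₁ e₂ i₁ i₂ := by
  classical
  obtain ⟨e₁, e₂, he₁, he₂, ⟨Φ⟩⟩ := h
  let π : ballComplement e₁ ⊕ ballComplement e₂ → ConnectedSum e₁ e₂ := Quot.mk _
  have hπ : IsQuotientMap π := isQuotientMap_quot_mk
  -- the normal form of a point, which prefers the first summand
  have hs₁ : ∀ x ∈ sphere (0 : EuclideanSpace ℝ (Fin n)) 1, e₁ x ∈ ballComplement e₁ :=
    fun x hx ⟨y, hy, hyx⟩ => by
      rw [he₁.injective hyx, mem_ball_zero_iff, mem_sphere_zero_iff_norm.1 hx] at hy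
      exact lt_irrefl _ hy
  have hex : ∀ b : ballComplement e₂, ∃ s : ballComplement e₁ ⊕ ballComplement e₂,
      (∀ x (hx : x ∈ sphere 0 1), (b : M₂) = e₂ x → s = Sum.inl ⟨e₁ x, hs₁ x hx⟩) ∧
      ((∀ x ∈ sphere 0 1, (b : M₂) ≠ e₂ x) → s = Sum.inr b) := fun b => by
    by_cases hb : ∃ x ∈ sphere 0 1, (b : M₂) = e₂ x
    · obtain ⟨x, hx, hbx⟩ := hb
      refine ⟨Sum.inl ⟨e₁ x, hs₁ x hx⟩, fun x' hx' hbx' => ?_, fun h1 => absurd hbx (h1 x hx)⟩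
      have : x = x' := he₂.injective (hbx.symm.trans hbx')
      subst this
      rfl
    · push Not at hb
      exact ⟨Sum.inr b, fun x hx hbx => absurd hbx (hb x hx), fun _ => rfl⟩
  choose r hr1 hr2 using hex
  let ν : ConnectedSum e₁ e₂ → ballComplement e₁ ⊕ ballComplement e₂ :=
    Quot.lift (Sum.elim Sum.inl r) (by
      rintro _ _ ⟨x, hx, a, b, rfl, rfl, ha, hb⟩
      rw [Sum.elim_inl, Sum.elim_inr, hr1 b x hx hb]
      congr 1
      exact Subtype.ext ha)
  have hν1 : ∀ a, ν (π (Sum.inl a)) = Sum.inl a := fun a => rfl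
  have hν2 : ∀ b, ν (π (Sum.inr b)) = r b := fun b => rfl
  have hglue : ∀ a b, π (Sum.inl a) = π (Sum.inr b) ↔
      ∃ x ∈ sphere 0 1, (a : M₁) = e₁ x ∧ (b : M₂) = e₂ x := fun a b => by
    constructor
    · intro hab
      have h1 : Sum.inl a = r b := by rw [← hν1, ← hν2, hab]
      by_contra! h2
      by_cases hb : ∃ x ∈ sphere 0 1, (b : M₂) = e₂ x
      · obtain ⟨x, hx, hbx⟩ := hb
        rw [hr1 b x hx hbx] at h1
        exact h2 x hx (congr_arg Subtype.val (Sum.inl_injective h1)) hbx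
      · push Not at hb
        rw [hr2 b hb] at h1
        exact Sum.inl_ne_inr h1
    · rintro ⟨x, hx, ha, hb⟩
      exact Quot.sound ⟨x, hx, a, b, rfl, rfl, ha, hb⟩
  refine ⟨e₁, e₂, fun a => Φ.symm (π (Sum.inl a)), fun b => Φ.symm (π (Sum.inr b)), he₁, he₂,
    Φ.symm.continuous.comp (hπ.continuous.comp continuous_inl),
    Φ.symm.continuous.comp (hπ.continuous.comp continuous_inr), fun a a' haa => ?_,
    fun b b' hbb => ?_, fun a b => ?_, ?_, fun W h1 h2 => ?_⟩
  · have h1 := congr_arg ν (Φ.symm.injective haa)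
    exact Sum.inl_injective h1
  · have h0 : π (Sum.inr b) = π (Sum.inr b') := Φ.symm.injective hbb
    have h1 : r b = r b' := congr_arg ν h0
    by_cases hb : ∃ x ∈ sphere 0 1, (b : M₂) = e₂ x
    · obtain ⟨x, hx, hbx⟩ := hb
      have h2 : π (Sum.inl ⟨e₁ x, hs₁ x hx⟩) = π (Sum.inr b') := by
        rw [← h0]; exact (hglue _ _).2 ⟨x, hx, rfl, hbx⟩
      obtain ⟨z, hz, hxz, hbz⟩ := (hglue _ _).1 h2
      have h3 : x = z := he₁.injective hxz
      exact Subtype.ext (by rw [hbx, hbz, h3])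
    · by_cases hb' : ∃ x ∈ sphere 0 1, (b' : M₂) = e₂ x
      · obtain ⟨x, hx, hbx⟩ := hb'
        push Not at hb
        rw [hr2 b hb, hr1 b' x hx hbx] at h1
        exact absurd h1.symm Sum.inl_ne_inr
      · push Not at hb hb'
        rw [hr2 b hb, hr2 b' hb'] at h1
        exact Sum.inr_injective h1
  · exact Φ.symm.injective.eq_iff.trans (hglue a b)
  · refine eq_univ_of_forall fun m => ?_
    obtain ⟨s, hs⟩ := hπ.surjective (Φ m)
    rcases s with a | b
    · exact Or.inl ⟨a, by simp only [hs, Φ.symm_apply_apply]⟩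
    · exact Or.inr ⟨b, by simp only [hs, Φ.symm_apply_apply]⟩
  · have h3 : IsOpen (π ⁻¹' (Φ.symm ⁻¹' W)) := isOpen_sum_iff.2 ⟨h1, h2⟩
    exact Φ.symm.isOpen_preimage.1 (hπ.isOpen_preimage.1 h3)

theorem IsInside.isInnermost_or {V M : Type*} [NormedAddCommGroup V] [NormedSpace ℝ V]
    {p c : V → M} {l : V → V} {U : Set V} (hl : IsPuncturedLift p c l) (hU : IsInside l U)
    (hne : ∀ y ∈ U, ∀ x ∈ sphere (0 : V) 1, p y ≠ c x) :
    IsInnermost p c l U ∨ IsInnermost p (c ∘ sphereInv) (l ∘ sphereInv) U := by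
  have hS : sphereInv '' sphere (0 : V) 1 = sphere 0 1 := by
    rw [image_sphereInv_eq_preimage]
    ext x
    simp [norm_sphereInv]
  have h1 : sphereInv '' {x : V | 1 < ‖x‖} = {x | x ≠ 0 ∧ ‖x‖ < 1} := by
    rw [image_sphereInv_eq_preimage]
    ext x
    simp only [mem_preimage, mem_ofPred_eq, norm_sphereInv, one_lt_inv_iff₀, norm_pos_iff]
  have h2 : sphereInv '' {x : V | x ≠ 0 ∧ ‖x‖ < 1} = {x | 1 < ‖x‖} := by
    rw [← h1, ← image_comp, show (sphereInv ∘ sphereInv : V → V) = id from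
      funext sphereInv_sphereInv, image_id]
  rcases hU.sides with ⟨hs1, hs2⟩ | ⟨hs1, hs2⟩
  · exact Or.inl { hl with
      isOpen := hU.isOpen
      isBounded := hU.isBounded
      disjoint := hU.disjoint
      isClosed_union := hU.isClosed_union
      outer_subset := hs1
      inner_disjoint := hs2
      map_ne := hne }
  · exact Or.inr
      { continuousOn := hl.continuousOn.comp continuousOn_sphereInv
          fun x hx => sphereInv_ne_zero hx
        map_eq := fun x hx => hl.map_eq _ (sphereInv_ne_zero hx)
        isOpen := hU.isOpen
        isBounded := hU.isBounded
        disjoint := by rw [image_comp, hS]; exact hU.disjoint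
        isClosed_union := by rw [image_comp, hS]; exact hU.isClosed_union
        outer_subset := by rw [image_comp, h1]; exact hs1
        inner_disjoint := by rw [image_comp, h2]; exact hs2
        map_ne := fun y hy x hx => hne y hy _ (by rw [← hS]; exact ⟨x, hx, rfl⟩) }

theorem isHomotopySphere_of_homeomorph_onePoint {n : ℕ} {X : Type*} [TopologicalSpace X]
    (e : X ≃ₜ OnePoint (EuclideanSpace ℝ (Fin n))) : IsHomotopySphere n X :=
  ⟨e.symm.compactSpace, ⟨(e.trans (onePointEquivSphereOfFinrankEq (by simp))).toHomotopyEquiv⟩⟩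

/-- In dimension at least three, a summand of a manifold covered by Euclidean space is a sphere. -/
theorem IsConnectedSum.isHomotopySphere_or {n : ℕ} (hn : 2 < n) {M M₁ M₂ : Type*}
    [TopologicalSpace M] [T2Space M] [TopologicalSpace M₁] [T2Space M₁] [TopologicalSpace M₂]
    [T2Space M₂] (h : IsConnectedSum n M M₁ M₂) {p : EuclideanSpace ℝ (Fin n) → M}
    (hp : IsCoveringMap p) (hps : Function.Surjective p) :
    IsHomotopySphere n M₁ ∨ IsHomotopySphere n M₂ := by
  have hV : 2 < Module.rank ℝ (EuclideanSpace ℝ (Fin n)) := by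
    rw [← Module.finrank_eq_rank, finrank_euclideanSpace_fin]
    exact_mod_cast hn
  have hnt : Nontrivial (EuclideanSpace ℝ (Fin n)) :=
    rank_pos_iff_nontrivial.1 (lt_trans (by norm_num) hV)
  obtain ⟨e₁, e₂, i₁, i₂, hg⟩ := h.exists_isGluing
  obtain ⟨c, hc⟩ := hg.exists_collar
  obtain ⟨l, U, hl, hU, hne⟩ := exists_innermost_lift hV hp hps (hc.isCollar hg)
  rcases hU.isInnermost_or hl hne with hin | hin
  · obtain ⟨e⟩ := hin.nonempty_homeomorph_onePoint (hc.isSide hg) hp.isLocalHomeomorph hps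
      (exists_isOpenEmbedding_onePoint_range_eq_compl n)
    exact Or.inl (isHomotopySphere_of_homeomorph_onePoint e)
  · obtain ⟨e⟩ := hin.nonempty_homeomorph_onePoint (hc.symm.isSide hg.symm) hp.isLocalHomeomorph hps
      (exists_isOpenEmbedding_onePoint_range_eq_compl n)
    exact Or.inr (isHomotopySphere_of_homeomorph_onePoint e)

end ConnectedSum

end

theorem lemma4p1 {M : Type u} [TopologicalSpace M] [T2Space M] [SecondCountableTopology M]
    [ChartedSpace (EuclideanSpace ℝ (Fin 4)) M]
    {E : Type*} [TopologicalSpace E] (p : E → M) (hp : IsUniversalCovering p)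
    (hE : Nonempty (E ≃ₜ EuclideanSpace ℝ (Fin 4))) :
    IsIrreducibleManifold.{u, v, w} 4 M := by
  obtain ⟨Φ⟩ := hE
  intro M₁ M₂ _ _ _ _ _ _ _ _ hM
  exact hM.isHomotopySphere_or (by norm_num) (p := p ∘ Φ.symm)
    (hp.isCoveringMap.comp_homeomorph Φ.symm) (hp.surjective.comp Φ.symm.surjective)
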